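/- In the problem \textsc{Partial Superstring} one is given a finite collection (multiset) $S$ of strings over an alphabet $\Sigma$ and non-negative integers $k,\ell$, and asks whether there is a string $s$ of length at most $\ell$ and a subcollection $S'\subseteq S$ of at least $k$ strings (counted with multiplicity) such that every string of $S'$ is a substring (a contiguous block of letters) of $s$. The alphabet is not fixed in advance: letters are natural numbers, and letters and the number $k$ are written in binary in the input. \textsc{Partial Superstring} is fixed-parameter tractable when parameterized by $\ell$. That is, there are a deterministic Turing machine, a function $f\colon\mathbb{N}\to\mathbb{N}$ and a constant $c$ such that for every input word $I$ and every $\ell\in\mathbb{N}$ the machine decides, within $f(\ell)\cdot(|I|+1)^{c}$ steps, whether $I$ encodes a pair $(S,k)$ for which $(S,k,\ell)$ is a yes-instance of \textsc{Partial Superstring}. -/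

import Mathlib

/-! ### Parameterized problems and fixed-parameter tractability -/

/-- A parameterized problem over the alphabet `Γ` of symbols: a set of pairs `(I, p)`, where the
input `I` is a word over `Γ` and the parameter `p` is a natural number. -/
abbrev ParameterizedProblem (Γ : Type) : Type := Set (List Γ × ℕ)

/-- The word that a Turing machine reads on the pair `(I, p)`: the input `I`, followed by the
binary digits of the parameter `p`, the latter written with two symbols of their own. -/
def ParameterizedProblem.inputWord {Γ : Type} (I : List Γ) (p : ℕ) : List (Γ ⊕ Bool) :=
  I.map Sum.inl ++ (Computability.encodeNat p).map Sum.inr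

open Classical in
/-- A parameterized problem `P` is fixed-parameter tractable if one deterministic (multi-stack)
Turing machine decides, for *every* word `I` and every `p`, whether `(I, p) ∈ P`, within
`f p * |I| ^ O(1)` steps for some function `f`. The length `|I|` is increased by one in order that
the bound makes sense for the empty word. -/
def ParameterizedProblem.IsFPT {Γ : Type} (P : ParameterizedProblem Γ) : Prop :=
  ∃ (M : Turing.TM2ComputableAux (Γ ⊕ Bool) Bool) (f : ℕ → ℕ) (c : ℕ),
    ∀ (I : List Γ) (p : ℕ),
      Nonempty (Turing.TM2OutputsInTime M.tm
        ((ParameterizedProblem.inputWord I p).map M.inputAlphabet.symm)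
        (some ([decide ((I, p) ∈ P)].map M.outputAlphabet.symm))
        (f p * (I.length + 1) ^ c))

/-! ### The problem Partial Superstring -/

/-- `(S, k, ℓ)` is a yes-instance of Partial Superstring: there is a string `s` of length at most
`ℓ` that contains, as contiguous substrings, all members of a subcollection `S'` of the multiset
`S` with at least `k` members, counted with multiplicity. -/
def HasPartialSuperstring {α : Type*} (S : Multiset (List α)) (k ℓ : ℕ) : Prop :=
  ∃ s : List α, s.length ≤ ℓ ∧
    ∃ S' : Multiset (List α), S' ≤ S ∧ k ≤ Multiset.card S' ∧ ∀ x ∈ S', x <:+: s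

/-- The symbols with which instances are written down. -/
inductive InstanceSymbol : Type
  | bit (b : Bool)
  | endLetter
  | endString

namespace InstanceSymbol

/-- A natural number in binary (least significant digit first). -/
def encodeNumber (n : ℕ) : List InstanceSymbol :=
  (Computability.encodeNat n).map bit

/-- A string: its letters one after the other, each in binary and closed by `endLetter`; then
`endString`. -/
def encodeString (s : List ℕ) : List InstanceSymbol :=
  s.flatMap (fun a => encodeNumber a ++ [endLetter]) ++ [endString]

/-- The strings of a collection, listed one after the other, followed by the number `k` in
binary. -/
def encodeInstance (S : List (List ℕ)) (k : ℕ) : List InstanceSymbol :=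
  S.flatMap encodeString ++ encodeNumber k

end InstanceSymbol

/-- Partial Superstring, parameterized by the length `ℓ` of the superstring. The alphabet is not
fixed in advance: letters are arbitrary natural numbers, written in binary. The collection `S` is
written down as a list in any order, with repetitions, and read as a multiset. Words that do not
encode an instance do not belong to the problem. -/
def partialSuperstringByLength : ParameterizedProblem InstanceSymbol :=
  {q | ∃ (S : List (List ℕ)) (k : ℕ), q.1 = InstanceSymbol.encodeInstance S k ∧
    HasPartialSuperstring (S : Multiset (List ℕ)) k q.2}

/-! Let `n` be the parameter. A superstring `s` is built from its last letter to its first. When a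
letter is prepended, the members of `S` that start there are prefixes of the current suffix `t` of
`s`, so it is enough to remember a prefix `q` of `t` that is empty or a suffix of a member of `S`,
together with a count `v`. There are polynomially many such pairs, and remembering the longest
possible `q` loses nothing (`IsLongest.tail`).

The obstacle is that a string may occur several times in `s` but must be counted once. So each
string `y` is given beforehand the only stage `τ y` at which it may be counted. The count is then
never too large, whatever `τ` is (`lastRow_sound`), and it is large enough if `τ` is right on the
members of `S` that occur in `s` (`lastRow_complete`). At most `(n + 1) * (n + 1)` different strings
occur in `s`.

A suitable `τ` is found by exhaustive search, a deterministic form of colour coding. Different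
members of `S` get different binary words of a common length `L`, where `2 ^ L` is linear in the
size of `S`. By `exists_mask`, for any set of such words some selection of bit positions allows
every function on the set to be read off from a decision tree whose height exceeds that of the
values by at most the size of the set. There are `2 ^ L` masks, hence polynomially many, and the
number of trees depends on `n` only; `search` tries all pairs.

To obtain a Turing machine, point-free programs on binary trees are compiled to structured stack
programs (`runs_compile`), and these to machines with the same number of steps (`Exec.stepsTo`). The
class `Poly` of polynomial-time functions is closed under the needed operations, above all under
folds whose accumulator grows in a controlled way (`Poly.foldl`). The trees and stages depend only
on the parameter and are computed with no time bound (`Computed`); `exists_code` combines both kinds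
of computation. Letters stay binary words, as only their equality matters, and `k` is capped just
above the size of `S`, so that counts can be unary. Ill-formed input is recognised because parsing
is a bijection (`textState_foldr`, `foldr_textState`). -/

/-! ### A structured language for multi-stack machines -/

namespace StackProg

open Turing

/-- Structured programs over stacks with alphabets `Γ k` and a finite memory `σ`. -/
inductive Prog {K : Type} (Γ : K → Type) (σ : Type) : Type
  | push (k : K) (f : σ → Γ k)
  | pop (k : K) (f : σ → Option (Γ k) → σ)
  | load (f : σ → σ)
  | seq (p q : Prog Γ σ)
  | ite (c : σ → Bool) (p q : Prog Γ σ)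
  | loop (c : σ → Bool) (p : Prog Γ σ)

variable {K : Type} {Γ : K → Type} {σ : Type}

/-- The program points of a structured program. -/
def Prog.Lab : Prog Γ σ → Type
  | .push _ _ => Unit
  | .pop _ _ => Unit
  | .load _ => Unit
  | .seq p q => p.Lab ⊕ q.Lab
  | .ite _ p q => Option (p.Lab ⊕ q.Lab)
  | .loop _ p => Option p.Lab

/-- There are finitely many program points. -/
@[reducible] def Prog.labFintype : (p : Prog Γ σ) → Fintype p.Lab
  | .push _ _ => inferInstanceAs (Fintype Unit)
  | .pop _ _ => inferInstanceAs (Fintype Unit)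
  | .load _ => inferInstanceAs (Fintype Unit)
  | .seq p q =>
    letI := p.labFintype
    letI := q.labFintype
    inferInstanceAs (Fintype (p.Lab ⊕ q.Lab))
  | .ite _ p q =>
    letI := p.labFintype
    letI := q.labFintype
    inferInstanceAs (Fintype (Option (p.Lab ⊕ q.Lab)))
  | .loop _ p =>
    letI := p.labFintype
    inferInstanceAs (Fintype (Option p.Lab))

/-- The first program point. -/
def Prog.entry : (p : Prog Γ σ) → p.Lab
  | .push _ _ => ()
  | .pop _ _ => ()
  | .load _ => ()
  | .seq p _ => Sum.inl p.entry
  | .ite _ _ _ => (none : Option _)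
  | .loop _ _ => (none : Option _)

/-- The machine statements of a structured program, whose program points are embedded into a
larger set of labels, and which continues at the label `exit`. -/
def Prog.code {Λ : Type} : (p : Prog Γ σ) → (p.Lab → Λ) → Λ → p.Lab → TM2.Stmt Γ Λ σ
  | .push k f, _, exit => fun _ => .push k f (.goto fun _ => exit)
  | .pop k f, _, exit => fun _ => .pop k f (.goto fun _ => exit)
  | .load f, _, exit => fun _ => .load f (.goto fun _ => exit)
  | .seq p q, inj, exit => fun l => match l with
    | Sum.inl l => p.code (fun x => inj (Sum.inl x)) (inj (Sum.inr q.entry)) l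
    | Sum.inr l => q.code (fun x => inj (Sum.inr x)) exit l
  | .ite c p q, inj, exit => fun l => match l with
    | none => .branch c (.goto fun _ => inj (some (Sum.inl p.entry)))
        (.goto fun _ => inj (some (Sum.inr q.entry)))
    | some (Sum.inl l) => p.code (fun x => inj (some (Sum.inl x))) exit l
    | some (Sum.inr l) => q.code (fun x => inj (some (Sum.inr x))) exit l
  | .loop c p, inj, exit => fun l => match l with
    | none => .branch c (.goto fun _ => inj (some p.entry)) (.goto fun _ => exit)
    | some l => p.code (fun x => inj (some x)) (inj none) l

variable [DecidableEq K]

/-- Big-step semantics with running times. -/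
inductive Exec : Prog Γ σ → σ × (∀ k, List (Γ k)) → ℕ → σ × (∀ k, List (Γ k)) → Prop
  | push (k f v S) : Exec (.push k f) (v, S) 1 (v, Function.update S k (f v :: S k))
  | pop (k f v S) :
      Exec (.pop k f) (v, S) 1 (f v (S k).head?, Function.update S k (S k).tail)
  | load (f v S) : Exec (.load f) (v, S) 1 (f v, S)
  | seq {p q X s Y t Z} : Exec p X s Y → Exec q Y t Z → Exec (.seq p q) X (s + t) Z
  | ite_true {c p q v S t Z} : c v = true → Exec p (v, S) t Z →
      Exec (.ite c p q) (v, S) (t + 1) Z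
  | ite_false {c p q v S t Z} : c v = false → Exec q (v, S) t Z →
      Exec (.ite c p q) (v, S) (t + 1) Z
  | loop_false {c p v S} : c v = false → Exec (.loop c p) (v, S) 1 (v, S)
  | loop_true {c p v S s Y t Z} : c v = true → Exec p (v, S) s Y → Exec (.loop c p) Y t Z →
      Exec (.loop c p) (v, S) (s + t + 1) Z

theorem Exec.cast {p : Prog Γ σ} {X Y Y' : σ × (∀ k, List (Γ k))} {t t' : ℕ} (h : Exec p X t Y)
    (ht : t = t') (hY : Y = Y') : Exec p X t' Y' := ht ▸ hY ▸ h

/-- `t` steps of a machine. -/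
def StepsTo {Λ : Type} (M : Λ → TM2.Stmt Γ Λ σ) (a : TM2.Cfg Γ Λ σ) (t : ℕ)
    (b : TM2.Cfg Γ Λ σ) : Prop :=
  (flip bind (TM2.step M))^[t] (some a) = some b

theorem StepsTo.trans {Λ : Type} {M : Λ → TM2.Stmt Γ Λ σ} {a b c : TM2.Cfg Γ Λ σ} {s t : ℕ}
    (h : StepsTo M a s b) (h' : StepsTo M b t c) : StepsTo M a (s + t) c := by
  unfold StepsTo at *
  rw [add_comm, Function.iterate_add_apply, h, h']

theorem StepsTo.single {Λ : Type} {M : Λ → TM2.Stmt Γ Λ σ} {a b : TM2.Cfg Γ Λ σ}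
    (h : TM2.step M a = some b) : StepsTo M a 1 b := h

/-- Every program point performs one operation or test and then jumps, so the step counts agree
exactly. Sequencing is free because the exit of the first part is the entry of the second; the exit
of a loop body is the loop test. The label embedding and the exit are arbitrary, since the induction
passes to subprograms with other ones. -/
theorem Exec.stepsTo {p : Prog Γ σ} {X : σ × (∀ k, List (Γ k))} {t : ℕ}
    {Y : σ × (∀ k, List (Γ k))} (h : Exec p X t Y) {Λ : Type} (M : Λ → TM2.Stmt Γ Λ σ)
    (inj : p.Lab → Λ) (exit : Λ) (hM : ∀ l, M (inj l) = p.code inj exit l) :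
    StepsTo M ⟨some (inj p.entry), X.1, X.2⟩ t ⟨some exit, Y.1, Y.2⟩ := by
  induction h generalizing Λ exit with
  | push k f v S => exact .single (by simp only [TM2.step, hM]; rfl)
  | pop k f v S => exact .single (by simp only [TM2.step, hM]; rfl)
  | load f v S => exact .single (by simp only [TM2.step, hM]; rfl)
  | seq _ _ ih₁ ih₂ =>
    exact (ih₁ M (fun x => inj (Sum.inl x)) _ fun l => hM (Sum.inl l)).trans
      (ih₂ M (fun x => inj (Sum.inr x)) exit fun l => hM (Sum.inr l))
  | @ite_true c p q v S t Z hc _ ih =>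
    rw [add_comm]
    refine StepsTo.trans (.single ?_)
      (ih M (fun x => inj (some (Sum.inl x))) exit fun l => hM (some (Sum.inl l)))
    have : M (inj (Prog.entry (.ite c p q))) = _ := hM none
    simp only [TM2.step, this, Prog.code, TM2.stepAux, hc, cond_true]
  | @ite_false c p q v S t Z hc _ ih =>
    rw [add_comm]
    refine StepsTo.trans (.single ?_)
      (ih M (fun x => inj (some (Sum.inr x))) exit fun l => hM (some (Sum.inr l)))
    have : M (inj (Prog.entry (.ite c p q))) = _ := hM none
    simp only [TM2.step, this, Prog.code, TM2.stepAux, hc, cond_false]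
  | @loop_false c p v S hc =>
    refine .single ?_
    have : M (inj (Prog.entry (.loop c p))) = _ := hM none
    simp only [TM2.step, this, Prog.code, TM2.stepAux, hc, cond_false]
  | @loop_true c p v S s Y t Z hc _ _ ih₁ ih₂ =>
    rw [add_comm]
    refine StepsTo.trans (.single ?_)
      (StepsTo.trans (ih₁ M (fun x => inj (some x)) (inj none) fun l => hM (some l))
        (ih₂ M inj exit hM))
    have : M (inj (Prog.entry (.loop c p))) = _ := hM none
    simp only [TM2.step, this, Prog.code, TM2.stepAux, hc, cond_true]

/-- From every memory content the program leads from the stacks `S` to the stacks `S'` within `t`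
steps. -/
def Runs (p : Prog Γ σ) (S : ∀ k, List (Γ k)) (t : ℕ) (S' : ∀ k, List (Γ k)) : Prop :=
  ∀ v, ∃ v' s, s ≤ t ∧ Exec p (v, S) s (v', S')

theorem Runs.seq {p q : Prog Γ σ} {S S' S'' : ∀ k, List (Γ k)} {s t : ℕ} (h : Runs p S s S')
    (h' : Runs q S' t S'') : Runs (.seq p q) S (s + t) S'' := by
  intro v
  obtain ⟨v', s', hs, e⟩ := h v
  obtain ⟨v'', t', ht, e'⟩ := h' v'
  exact ⟨v'', _, add_le_add hs ht, e.seq e'⟩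

theorem Runs.mono {p : Prog Γ σ} {S S' : ∀ k, List (Γ k)} {s t : ℕ} (h : Runs p S s S')
    (hst : s ≤ t) : Runs p S t S' := fun v =>
  let ⟨v', s', hs, e⟩ := h v
  ⟨v', s', hs.trans hst, e⟩

/-- A program whose memory content is known after a prelude. -/
theorem Runs.of_exec {p : Prog Γ σ} {S S' : ∀ k, List (Γ k)} {t : ℕ}
    (h : ∀ v, ∃ v', Exec p (v, S) t (v', S')) : Runs p S t S' := fun v =>
  let ⟨v', e⟩ := h v
  ⟨v', t, le_rfl, e⟩

end StackProg

/-! ### The concrete machine model: five stacks and a finite memory -/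

namespace StackProg

/-- The stacks: the input, the stack of values, two auxiliary stacks, and a counter. -/
inductive Stk : Type
  | inp | a | b | c | n
  deriving DecidableEq

instance : Fintype Stk where
  elems := {.inp, .a, .b, .c, .n}
  complete := fun k => by cases k <;> simp

/-- The alphabets of the stacks. On the auxiliary stacks `none` is a mark. -/
abbrev Alph (X : Type) : Stk → Type
  | .inp => X
  | .a => Bool
  | .b => Option Bool
  | .c => Option Bool
  | .n => Unit

/-- The finite memory. -/
structure Mem (X : Type) : Type where
  flag : Bool
  sym : Bool
  fst : Option Bool
  snd : Option Bool
  read : Option X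

/-- The memory at the start. -/
def Mem.init (X : Type) : Mem X := ⟨false, false, none, none, none⟩

instance {X : Type} [Fintype X] : Fintype (Mem X) :=
  Fintype.ofEquiv (Bool × Bool × Option Bool × Option Bool × Option X)
    { toFun := fun p => ⟨p.1, p.2.1, p.2.2.1, p.2.2.2.1, p.2.2.2.2⟩
      invFun := fun m => (m.flag, m.sym, m.fst, m.snd, m.read)
      left_inv := fun _ => rfl
      right_inv := fun _ => rfl }

variable {X : Type}

/-- The contents of the stacks. -/
def stk (i : List X) (a : List Bool) (b c : List (Option Bool)) (n : List Unit) :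
    ∀ k, List (Alph X k)
  | .inp => i
  | .a => a
  | .b => b
  | .c => c
  | .n => n

/-- Programs for the machines with these stacks. -/
abbrev MProg (X : Type) := Prog (Alph X) (Mem X)

section Basic

variable {i : List X} {a : List Bool} {b c : List (Option Bool)} {n : List Unit}

theorem exec_push_a (f : Mem X → Bool) (v : Mem X) :
    Exec (.push Stk.a f : MProg X) (v, stk i a b c n) 1 (v, stk i (f v :: a) b c n) := by
  refine (Exec.push (Γ := Alph X) Stk.a f v (stk i a b c n)).cast rfl (congrArg (Prod.mk _) ?_)
  funext k; cases k <;> rfl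

theorem exec_push_b (f : Mem X → Option Bool) (v : Mem X) :
    Exec (.push Stk.b f : MProg X) (v, stk i a b c n) 1 (v, stk i a (f v :: b) c n) := by
  refine (Exec.push (Γ := Alph X) Stk.b f v (stk i a b c n)).cast rfl (congrArg (Prod.mk _) ?_)
  funext k; cases k <;> rfl

theorem exec_push_c (f : Mem X → Option Bool) (v : Mem X) :
    Exec (.push Stk.c f : MProg X) (v, stk i a b c n) 1 (v, stk i a b (f v :: c) n) := by
  refine (Exec.push (Γ := Alph X) Stk.c f v (stk i a b c n)).cast rfl (congrArg (Prod.mk _) ?_)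
  funext k; cases k <;> rfl

theorem exec_push_n (f : Mem X → Unit) (v : Mem X) :
    Exec (.push Stk.n f : MProg X) (v, stk i a b c n) 1 (v, stk i a b c (() :: n)) := by
  refine (Exec.push (Γ := Alph X) Stk.n f v (stk i a b c n)).cast rfl (congrArg (Prod.mk _) ?_)
  funext k; cases k <;> rfl

theorem exec_pop_inp (f : Mem X → Option X → Mem X) (v : Mem X) :
    Exec (.pop Stk.inp f : MProg X) (v, stk i a b c n) 1
      (f v i.head?, stk i.tail a b c n) := by
  refine (Exec.pop (Γ := Alph X) Stk.inp f v (stk i a b c n)).cast rfl (congrArg (Prod.mk _) ?_)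
  funext k; cases k <;> rfl

theorem exec_pop_a (f : Mem X → Option Bool → Mem X) (v : Mem X) :
    Exec (.pop Stk.a f : MProg X) (v, stk i a b c n) 1
      (f v a.head?, stk i a.tail b c n) := by
  refine (Exec.pop (Γ := Alph X) Stk.a f v (stk i a b c n)).cast rfl (congrArg (Prod.mk _) ?_)
  funext k; cases k <;> rfl

theorem exec_pop_b (f : Mem X → Option (Option Bool) → Mem X) (v : Mem X) :
    Exec (.pop Stk.b f : MProg X) (v, stk i a b c n) 1
      (f v b.head?, stk i a b.tail c n) := by
  refine (Exec.pop (Γ := Alph X) Stk.b f v (stk i a b c n)).cast rfl (congrArg (Prod.mk _) ?_)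
  funext k; cases k <;> rfl

theorem exec_pop_c (f : Mem X → Option (Option Bool) → Mem X) (v : Mem X) :
    Exec (.pop Stk.c f : MProg X) (v, stk i a b c n) 1
      (f v c.head?, stk i a b c.tail n) := by
  refine (Exec.pop (Γ := Alph X) Stk.c f v (stk i a b c n)).cast rfl (congrArg (Prod.mk _) ?_)
  funext k; cases k <;> rfl

theorem exec_pop_n (f : Mem X → Option Unit → Mem X) (v : Mem X) :
    Exec (.pop Stk.n f : MProg X) (v, stk i a b c n) 1
      (f v n.head?, stk i a b c n.tail) := by
  refine (Exec.pop (Γ := Alph X) Stk.n f v (stk i a b c n)).cast rfl (congrArg (Prod.mk _) ?_)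
  funext k; cases k <;> rfl

end Basic

section Loop

variable {K : Type} {Γ : K → Type} {σ : Type} [DecidableEq K]

/-- Some iterations of a loop. -/
inductive Iter (c : σ → Bool) (p : Prog Γ σ) :
    σ × (∀ k, List (Γ k)) → ℕ → σ × (∀ k, List (Γ k)) → Prop
  | refl Y : Iter c p Y 0 Y
  | step {v S s Y t Z} : c v = true → Exec p (v, S) s Y → Iter c p Y t Z →
      Iter c p (v, S) (s + 1 + t) Z

/-- `Exec` describes only completed loops. Partial runs can be concatenated, as is needed when a
loop reads two subtrees in succession. -/
theorem Iter.trans {c : σ → Bool} {p : Prog Γ σ} {X Y Z : σ × (∀ k, List (Γ k))} {s t : ℕ}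
    (h : Iter c p X s Y) (h' : Iter c p Y t Z) : Iter c p X (s + t) Z := by
  induction h with
  | refl => simpa using h'
  | step hc e _ ih => rw [add_assoc]; exact .step hc e (ih h')

theorem Iter.exec_loop {c : σ → Bool} {p : Prog Γ σ} {X Y : σ × (∀ k, List (Γ k))} {t : ℕ}
    (h : Iter c p X t Y) (hc : c Y.1 = false) : Exec (.loop c p) X (t + 1) Y := by
  induction h with
  | refl X => simpa using Exec.loop_false (S := X.2) hc
  | @step v S s Y t Z hc' e _ ih =>
    have := Exec.loop_true hc' e (ih hc)
    convert this using 1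
    omega

end Loop

/-! ### Binary trees and their prefix code -/

/-- Binary trees, the data of the functional language. -/
inductive T : Type
  | nil
  | node (l r : T)
  deriving DecidableEq

namespace T

/-- The number of nodes and leaves. -/
def size : T → ℕ
  | nil => 1
  | node l r => 1 + l.size + r.size

/-- The prefix code of a tree. -/
def word : T → List Bool
  | nil => [false]
  | node l r => true :: (l.word ++ r.word)

@[simp] theorem length_word (t : T) : t.word.length = t.size := by
  induction t with
  | nil => rfl
  | node l r hl hr => simp [word, size, hl, hr]; omega

theorem size_pos (t : T) : 1 ≤ t.size := by
  cases t <;> simp [size]; omega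

/-- The code is prefix-free. The trailing words are needed for the induction, where the code of a
left subtree is followed by that of the right one. -/
theorem word_append_inj {s t : T} {u v : List Bool} (h : s.word ++ u = t.word ++ v) :
    s = t ∧ u = v := by
  induction s generalizing t u v with
  | nil => cases t <;> simp_all [word]
  | node l r hl hr =>
    cases t with
    | nil => simp [word] at h
    | node l' r' =>
      simp only [word, List.cons_append, List.append_assoc, List.cons.injEq, true_and] at h
      obtain ⟨rfl, h'⟩ := hl h
      obtain ⟨rfl, h''⟩ := hr h'
      exact ⟨rfl, h''⟩

theorem word_injective : Function.Injective word := fun s t h =>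
  (word_append_inj (u := []) (v := []) (by simpa using h)).1

end T

/-! ### Moving trees between the stacks -/

section Routines

/-- Nothing. -/
def skip : MProg X := .load id

/-- Pop the counter, and remember whether it was positive. -/
def popCounter : MProg X := .pop Stk.n fun v x => { v with flag := x.isSome }

/-- Pop the stack of values. -/
def popValue : MProg X := .pop Stk.a fun v x => { v with sym := x.getD false }

/-- Move one symbol to the auxiliary stacks, and keep account of the number of trees that still
have to be read. -/
def scanBody : MProg X :=
  .seq popValue (.seq (.push Stk.b fun v => some v.sym) (.seq (.push Stk.c fun v => some v.sym)
    (.seq (.ite Mem.sym (.seq (.push Stk.n fun _ => ()) (.push Stk.n fun _ => ())) skip)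
      popCounter)))

/-- Move one tree from the stack of values to both auxiliary stacks, in reverse, above a mark. -/
def scan : MProg X :=
  .seq (.push Stk.b fun _ => none) (.seq (.push Stk.c fun _ => none)
    (.seq (.load fun v => { v with flag := true }) (.loop Mem.flag scanBody)))

/-- A word as it is kept on an auxiliary stack. -/
def saved (w : List Bool) (b : List (Option Bool)) : List (Option Bool) :=
  w.reverse.map some ++ b

theorem saved_cons (x : Bool) (w : List Bool) (b : List (Option Bool)) :
    saved (x :: w) b = saved w (some x :: b) := by simp [saved]

theorem saved_append (u w : List Bool) (b : List (Option Bool)) :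
    saved (u ++ w) b = saved w (saved u b) := by simp [saved]

theorem scanBody_true (i : List X) (a : List Bool) (b c : List (Option Bool)) (n : List Unit)
    (v : Mem X) : ∃ v', v'.flag = true ∧ Exec scanBody (v, stk i (true :: a) b c n) 7
      (v', stk i a (some true :: b) (some true :: c) (() :: n)) :=
  ⟨_, rfl, (exec_pop_a _ _).seq ((exec_push_b _ _).seq ((exec_push_c _ _).seq
    ((Exec.ite_true rfl ((exec_push_n _ _).seq (exec_push_n _ _))).seq (exec_pop_n _ _))))⟩

theorem scanBody_false (i : List X) (a : List Bool) (b c : List (Option Bool)) (n : List Unit)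
    (v : Mem X) : ∃ v', v'.flag = n.head?.isSome ∧
      Exec scanBody (v, stk i (false :: a) b c n) 6
        (v', stk i a (some false :: b) (some false :: c) n.tail) :=
  ⟨_, rfl, (exec_pop_a _ _).seq ((exec_push_b _ _).seq ((exec_push_c _ _).seq
    ((Exec.ite_false rfl (Exec.load id _ _)).seq (exec_pop_n _ _))))⟩

/-- The counter holds the number of trees still due after the current one. A node replaces one
pending tree by two, and a leaf completes one; the flag becomes false when a leaf finds the counter
empty. -/
theorem scan_iter (t : T) (i : List X) (a : List Bool) (b c : List (Option Bool))
    (n : List Unit) (v : Mem X) (hv : v.flag = true) : ∃ v' s, v'.flag = n.head?.isSome ∧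
      s ≤ 8 * t.size ∧ Iter Mem.flag scanBody (v, stk i (t.word ++ a) b c n) s
        (v', stk i a (saved t.word b) (saved t.word c) n.tail) := by
  induction t generalizing a b c n v with
  | nil =>
    obtain ⟨v', h, e⟩ := scanBody_false i a b c n v
    exact ⟨v', _, h, by simp [T.size], .step hv e (.refl _)⟩
  | node l r hl hr =>
    obtain ⟨v₁, h₁, e₁⟩ := scanBody_true i (l.word ++ (r.word ++ a)) b c n v
    obtain ⟨v₂, s₂, h₂, hs₂, e₂⟩ := hl (r.word ++ a) (some true :: b) (some true :: c) (() :: n)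
      v₁ h₁
    obtain ⟨v₃, s₃, h₃, hs₃, e₃⟩ := hr a (saved l.word (some true :: b))
      (saved l.word (some true :: c)) n v₂ h₂
    refine ⟨v₃, 7 + 1 + (s₂ + s₃), h₃, by simp only [T.size]; omega, ?_⟩
    simp only [T.word, saved_cons, saved_append, List.cons_append, List.append_assoc]
    exact Iter.step hv e₁ (e₂.trans e₃)

theorem runs_scan (t : T) (i : List X) (a : List Bool) (b c : List (Option Bool)) :
    Runs scan (stk i (t.word ++ a) b c []) (8 * t.size + 4)
      (stk i a (saved t.word (none :: b)) (saved t.word (none :: c)) []) := by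
  intro v
  obtain ⟨v', s, h, hs, e⟩ := scan_iter t i a (none :: b) (none :: c) []
    { v with flag := true } rfl
  exact ⟨v', _, by omega, (exec_push_b _ _).seq ((exec_push_c _ _).seq
    ((Exec.load _ _ _).seq (e.exec_loop h)))⟩

/-- Pop the first auxiliary stack. -/
def popB : MProg X := .pop Stk.b fun v x => { v with fst := x.join }

/-- Pop the second auxiliary stack. -/
def popC : MProg X := .pop Stk.c fun v x => { v with snd := x.join }

/-- Empty the first auxiliary stack up to the first mark. -/
def clearB : MProg X := .seq popB (.loop (fun v => v.fst.isSome) popB)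

/-- Empty the second auxiliary stack up to the first mark. -/
def clearC : MProg X := .seq popC (.loop (fun v => v.snd.isSome) popC)

/-- Move the top of the first auxiliary stack back to the stack of values. -/
def restoreB : MProg X :=
  .seq popB (.loop (fun v => v.fst.isSome) (.seq (.push Stk.a fun v => v.fst.getD false) popB))

/-- Move the top of the second auxiliary stack back to the stack of values. -/
def restoreC : MProg X :=
  .seq popC (.loop (fun v => v.snd.isSome) (.seq (.push Stk.a fun v => v.snd.getD false) popC))

variable (i : List X) (a : List Bool) (b c : List (Option Bool)) (n : List Unit)

theorem exec_popB_none (v : Mem X) : Exec popB (v, stk i a (none :: b) c n) 1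
    ({ v with fst := none }, stk i a b c n) := exec_pop_b _ _

theorem exec_popB_some (x : Bool) (v : Mem X) : Exec popB (v, stk i a (some x :: b) c n) 1
    ({ v with fst := some x }, stk i a b c n) := exec_pop_b _ _

/-- The opening pop is split off because each round of the loop ends with the pop that prepares the
next test. The first pop for the remaining word thus serves as the end of the current round. -/
theorem runs_clearB_aux (w : List Bool) (v : Mem X) : ∃ v₁ S₁ v₂,
    Exec popB (v, stk i a (w.map some ++ none :: b) c n) 1 (v₁, S₁) ∧
    Exec (.loop (fun v => v.fst.isSome) popB) (v₁, S₁) (2 * w.length + 1)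
      (v₂, stk i a b c n) := by
  induction w generalizing v with
  | nil => exact ⟨_, _, _, exec_popB_none i a b c n v, Exec.loop_false rfl⟩
  | cons x w ih =>
    obtain ⟨v₁, S₁, v₂, e₁, e₂⟩ := ih { v with fst := some x }
    refine ⟨_, _, v₂, exec_popB_some .., ?_⟩
    exact (Exec.loop_true rfl e₁ e₂).cast (by simp only [List.length_cons]; omega) rfl

theorem runs_clearB (w : List Bool) :
    Runs clearB (stk i a (saved w (none :: b)) c n) (2 * w.length + 2)
      (stk i a b c n) := by
  apply Runs.of_exec
  intro v
  obtain ⟨v₁, S₁, v₂, e₁, e₂⟩ := runs_clearB_aux i a b c n w.reverse v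
  refine ⟨v₂, ?_⟩
  exact (e₁.seq e₂).cast (by simp only [List.length_reverse]; omega) rfl

theorem runs_restoreB_aux (w : List Bool) (v : Mem X) : ∃ v₁ S₁ v₂,
    Exec popB (v, stk i a (w.map some ++ none :: b) c n) 1 (v₁, S₁) ∧
    Exec (.loop (fun v => v.fst.isSome) (.seq (.push Stk.a fun v => v.fst.getD false) popB))
      (v₁, S₁) (3 * w.length + 1) (v₂, stk i (w.reverse ++ a) b c n) := by
  induction w generalizing v a with
  | nil => exact ⟨_, _, _, exec_popB_none i a b c n v, Exec.loop_false rfl⟩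
  | cons x w ih =>
    obtain ⟨v₁, S₁, v₂, e₁, e₂⟩ := ih (x :: a) { v with fst := some x }
    refine ⟨_, _, v₂, exec_popB_some .., ?_⟩
    refine (Exec.loop_true (c := fun v => v.fst.isSome) rfl ((exec_push_a _ _).seq e₁)
      e₂).cast ?_ ?_
    · simp only [List.length_cons]; omega
    · simp

theorem runs_restoreB (w : List Bool) :
    Runs restoreB (stk i a (saved w (none :: b)) c n) (3 * w.length + 2)
      (stk i (w ++ a) b c n) := by
  apply Runs.of_exec
  intro v
  obtain ⟨v₁, S₁, v₂, e₁, e₂⟩ := runs_restoreB_aux i a b c n w.reverse v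
  refine ⟨v₂, ?_⟩
  exact (e₁.seq e₂).cast (by simp only [List.length_reverse]; omega) (by simp)

theorem exec_popC_none (v : Mem X) : Exec popC (v, stk i a b (none :: c) n) 1
    ({ v with snd := none }, stk i a b c n) := exec_pop_c _ _

theorem exec_popC_some (x : Bool) (v : Mem X) : Exec popC (v, stk i a b (some x :: c) n) 1
    ({ v with snd := some x }, stk i a b c n) := exec_pop_c _ _

theorem runs_clearC_aux (w : List Bool) (v : Mem X) : ∃ v₁ S₁ v₂,
    Exec popC (v, stk i a b (w.map some ++ none :: c) n) 1 (v₁, S₁) ∧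
    Exec (.loop (fun v => v.snd.isSome) popC) (v₁, S₁) (2 * w.length + 1)
      (v₂, stk i a b c n) := by
  induction w generalizing v with
  | nil => exact ⟨_, _, _, exec_popC_none i a b c n v, Exec.loop_false rfl⟩
  | cons x w ih =>
    obtain ⟨v₁, S₁, v₂, e₁, e₂⟩ := ih { v with snd := some x }
    refine ⟨_, _, v₂, exec_popC_some .., ?_⟩
    exact (Exec.loop_true rfl e₁ e₂).cast (by simp only [List.length_cons]; omega) rfl

theorem runs_clearC (w : List Bool) :
    Runs clearC (stk i a b (saved w (none :: c)) n) (2 * w.length + 2)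
      (stk i a b c n) := by
  apply Runs.of_exec
  intro v
  obtain ⟨v₁, S₁, v₂, e₁, e₂⟩ := runs_clearC_aux i a b c n w.reverse v
  refine ⟨v₂, ?_⟩
  exact (e₁.seq e₂).cast (by simp only [List.length_reverse]; omega) rfl

theorem runs_restoreC_aux (w : List Bool) (v : Mem X) : ∃ v₁ S₁ v₂,
    Exec popC (v, stk i a b (w.map some ++ none :: c) n) 1 (v₁, S₁) ∧
    Exec (.loop (fun v => v.snd.isSome) (.seq (.push Stk.a fun v => v.snd.getD false) popC))
      (v₁, S₁) (3 * w.length + 1) (v₂, stk i (w.reverse ++ a) b c n) := by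
  induction w generalizing v a with
  | nil => exact ⟨_, _, _, exec_popC_none i a b c n v, Exec.loop_false rfl⟩
  | cons x w ih =>
    obtain ⟨v₁, S₁, v₂, e₁, e₂⟩ := ih (x :: a) { v with snd := some x }
    refine ⟨_, _, v₂, exec_popC_some .., ?_⟩
    refine (Exec.loop_true (c := fun v => v.snd.isSome) rfl ((exec_push_a _ _).seq e₁)
      e₂).cast ?_ ?_
    · simp only [List.length_cons]; omega
    · simp

theorem runs_restoreC (w : List Bool) :
    Runs restoreC (stk i a b (saved w (none :: c)) n) (3 * w.length + 2)
      (stk i (w ++ a) b c n) := by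
  apply Runs.of_exec
  intro v
  obtain ⟨v₁, S₁, v₂, e₁, e₂⟩ := runs_restoreC_aux i a b c n w.reverse v
  refine ⟨v₂, ?_⟩
  exact (e₁.seq e₂).cast (by simp only [List.length_reverse]; omega) (by simp)

end Routines

end StackProg

namespace StackProg

/-! ### A functional language on binary trees -/

/-- Fold a function over a tree, read as a list along its right spine. -/
def T.foldl (g : T → T) : T → T → T
  | .nil, acc => acc
  | .node a l, acc => l.foldl g (g (.node a acc))

/-- Point-free programs on binary trees. -/
inductive Fn : Type
  | id
  | nil
  | fst
  | snd
  | eq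
  | pair (f g : Fn)
  | comp (g f : Fn)
  | ite (c f g : Fn)
  | fold (f : Fn)

namespace Fn

/-- The function that a program computes. -/
def eval : Fn → T → T
  | id => fun t => t
  | nil => fun _ => .nil
  | fst => fun t => match t with
    | .nil => .nil
    | .node l _ => l
  | snd => fun t => match t with
    | .nil => .nil
    | .node _ r => r
  | eq => fun t => match t with
    | .nil => .nil
    | .node l r => if l = r then .node .nil .nil else .nil
  | pair f g => fun t => .node (f.eval t) (g.eval t)
  | comp g f => fun t => g.eval (f.eval t)
  | ite c f g => fun t => match c.eval t with
    | .nil => g.eval t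
    | .node _ _ => f.eval t
  | fold f => fun t => match t with
    | .nil => .nil
    | .node l acc => l.foldl f.eval acc

/-- The time for folding, in terms of the time `c` for one step `g`. -/
def foldCost (g : T → T) (c : T → ℕ) : T → T → ℕ
  | .nil, acc => acc.size + 2
  | .node a l, acc => c (.node a acc) + 60 * (T.node a l).size + foldCost g c l (g (.node a acc))

/-- A bound for the running time of a program. -/
def cost : Fn → T → ℕ
  | id => fun t => t.size
  | nil => fun t => 60 * t.size
  | fst => fun t => 60 * t.size
  | snd => fun t => 60 * t.size
  | eq => fun t => 60 * t.size
  | pair f g => fun t => f.cost t + g.cost t + 60 * t.size + 60 * (f.eval t).size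
  | comp g f => fun t => f.cost t + g.cost (f.eval t)
  | ite c f g => fun t => c.cost t + 60 * t.size + 60 * (c.eval t).size +
    match c.eval t with
    | .nil => g.cost t
    | .node _ _ => f.cost t
  | fold f => fun t => match t with
    | .nil => 3
    | .node l acc => 2 + foldCost f.eval f.cost l acc

theorem size_foldl_le (g : T → T) (c : T → ℕ) (l acc : T) :
    (l.foldl g acc).size ≤ foldCost g c l acc := by
  induction l generalizing acc with
  | nil => simp [T.foldl, foldCost]
  | node a l _ ih => simp only [T.foldl, foldCost]; have := ih (g (.node a acc)); omega

/-- The cost is set up to dominate the output size as well, so that a time bound alone controls the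
input of the next program in a composition. -/
theorem size_eval_le (f : Fn) (t : T) : (f.eval t).size ≤ f.cost t := by
  induction f generalizing t with
  | id => simp [eval, cost]
  | nil => have := t.size_pos; simp [eval, cost, T.size]; omega
  | fst => cases t <;> simp [eval, cost, T.size]; omega
  | snd => cases t <;> simp [eval, cost, T.size]; omega
  | eq =>
    cases t with
    | nil => simp [eval, cost, T.size]
    | node l r =>
      have := l.size_pos
      simp only [eval, cost, T.size]
      split_ifs <;> simp only [T.size] <;> omega
  | pair f g hf hg =>
    have := hf t; have := hg t; have := t.size_pos
    simp only [eval, cost, T.size]; omega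
  | comp g f hg hf => have := hg (f.eval t); simp only [eval, cost]; omega
  | ite c f g hc hf hg =>
    have := hf t; have := hg t
    simp only [eval, cost]
    cases c.eval t <;> simp only <;> omega
  | fold f hf =>
    cases t with
    | nil => simp [eval, cost, T.size]
    | node l acc =>
      have := size_foldl_le f.eval f.cost l acc
      simp only [eval, cost]; omega

end Fn

/-! ### Compilation -/

section Compile

variable {X : Type}

/-- Remove the topmost tree. -/
def dropTop : MProg X := .seq scan (.seq clearB clearC)

/-- Duplicate the topmost tree. -/
def dupTop : MProg X := .seq scan (.seq restoreB restoreC)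

/-- Move the topmost tree to the first auxiliary stack. -/
def saveB : MProg X := .seq scan clearC

/-- Move the topmost tree to the second auxiliary stack. -/
def saveC : MProg X := .seq scan clearB

/-- Push one symbol on the stack of values. -/
def pushA (x : Bool) : MProg X := .push Stk.a fun _ => x

variable {i : List X} {a : List Bool} {b c : List (Option Bool)}

theorem runs_dropTop (t : T) :
    Runs dropTop (stk i (t.word ++ a) b c []) (20 * t.size) (stk i a b c []) := by
  refine ((runs_scan t i a b c).seq ((runs_clearB _ _ _ _ _ _).seq (runs_clearC _ _ _ _ _ _))).mono ?_
  have := t.size_pos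
  simp only [T.length_word]; omega

theorem runs_dupTop (t : T) :
    Runs dupTop (stk i (t.word ++ a) b c []) (22 * t.size)
      (stk i (t.word ++ (t.word ++ a)) b c []) := by
  refine ((runs_scan t i a b c).seq ((runs_restoreB _ _ _ _ _ _).seq (runs_restoreC _ _ _ _ _ _))).mono ?_
  have := t.size_pos
  simp only [T.length_word]; omega

theorem runs_saveB (t : T) :
    Runs saveB (stk i (t.word ++ a) b c []) (16 * t.size)
      (stk i a (saved t.word (none :: b)) c []) := by
  refine ((runs_scan t i a b c).seq (runs_clearC _ _ _ _ _ _)).mono ?_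
  have := t.size_pos
  simp only [T.length_word]; omega

theorem runs_saveC (t : T) :
    Runs saveC (stk i (t.word ++ a) b c []) (16 * t.size)
      (stk i a b (saved t.word (none :: c)) []) := by
  refine ((runs_scan t i a b c).seq (runs_clearB _ _ _ _ _ _)).mono ?_
  have := t.size_pos
  simp only [T.length_word]; omega

variable {n : List Unit}

theorem runs_pushA (x : Bool) :
    Runs (pushA x) (stk i a b c n) 1 (stk i (x :: a) b c n) :=
  .of_exec fun v => ⟨v, exec_push_a _ v⟩

theorem runs_skip {S : ∀ k, List (Alph X k)} : Runs skip S 1 S := .of_exec fun v => ⟨v, .load id v S⟩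

theorem runs_pop_ite_true {p q : MProg X} {t : ℕ} {S : ∀ k, List (Alph X k)}
    (h : Runs p (stk i a b c n) t S) :
    Runs (.seq popValue (.ite Mem.sym p q)) (stk i (true :: a) b c n) (t + 2) S := by
  intro v
  obtain ⟨v', s, hs, e⟩ := h { v with sym := true }
  exact ⟨v', _, by omega, (exec_pop_a _ _).seq (Exec.ite_true rfl e)⟩

theorem runs_pop_ite_false {p q : MProg X} {t : ℕ} {S : ∀ k, List (Alph X k)}
    (h : Runs q (stk i a b c n) t S) :
    Runs (.seq popValue (.ite Mem.sym p q)) (stk i (false :: a) b c n) (t + 2) S := by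
  intro v
  obtain ⟨v', s, hs, e⟩ := h { v with sym := false }
  exact ⟨v', _, by omega, (exec_pop_a _ _).seq (Exec.ite_false rfl e)⟩

theorem runs_pop_loop_false {p : MProg X} :
    Runs (.seq popValue (.loop Mem.sym p)) (stk i (false :: a) b c n) 2 (stk i a b c n) :=
  .of_exec fun v => ⟨_, (exec_pop_a _ v).seq (Exec.loop_false rfl)⟩

/-- The pop that opens the remaining run `h'` is the one that closes the current round, so the run
is taken apart and bracketed anew. -/
theorem runs_pop_loop_true {p : MProg X} {s t : ℕ} {S S' : ∀ k, List (Alph X k)}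
    (h : Runs p (stk i a b c n) s S)
    (h' : Runs (.seq popValue (.loop Mem.sym (.seq p popValue))) S t S') :
    Runs (.seq popValue (.loop Mem.sym (.seq p popValue))) (stk i (true :: a) b c n)
      (s + t + 2) S' := by
  intro v
  obtain ⟨v₁, s₁, hs₁, e₁⟩ := h { v with sym := true }
  obtain ⟨v₂, s₂, hs₂, e₂⟩ := h' v₁
  cases e₂ with
  | seq e₂ e₃ =>
    exact ⟨v₂, _, by omega, (exec_pop_a _ _).seq (Exec.loop_true rfl (e₁.seq e₂) e₃)⟩

/-- The loop that compares the tops of the two auxiliary stacks. -/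
def compareBody : MProg X :=
  .seq (.load fun v => { v with flag := v.flag && decide (v.fst = v.snd) })
    (.seq (.ite (fun v => v.fst.isSome) popB skip) (.ite (fun v => v.snd.isSome) popC skip))

/-- Compare the tops of the two auxiliary stacks. -/
def compareTops : MProg X :=
  .seq (.load fun v => { v with flag := true }) (.seq popB (.seq popC (.seq
    (.loop (fun v => v.fst.isSome || v.snd.isSome) compareBody)
    (.ite Mem.flag (.seq (pushA false) (.seq (pushA false) (pushA true))) (pushA false)))))

/-- What `popB` and `popC` leave behind. -/
def popped (u : List Bool) (b : List (Option Bool)) : List (Option Bool) :=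
  (u.map some ++ none :: b).tail

theorem exec_popB (u : List Bool) (v : Mem X) :
    Exec popB (v, stk i a (u.map some ++ none :: b) c n) 1
      ({ v with fst := u.head? }, stk i a (popped u b) c n) := by
  cases u
  · exact exec_popB_none ..
  · exact exec_popB_some ..

theorem exec_popC (u : List Bool) (v : Mem X) :
    Exec popC (v, stk i a b (u.map some ++ none :: c) n) 1
      ({ v with snd := u.head? }, stk i a b (popped u c) n) := by
  cases u
  · exact exec_popC_none ..
  · exact exec_popC_some ..

/-- The current heads are in the memory, already popped. A mismatch does not stop the loop: it runs
until both words and both marks are gone, so that the stacks end up clean in every case. -/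
theorem compare_loop (u w : List Bool) (v : Mem X) (hu : v.fst = u.head?) (hw : v.snd = w.head?) :
    ∃ v' s, v'.flag = (v.flag && decide (u = w)) ∧ s ≤ 6 * (u.length + w.length) + 1 ∧
      Exec (.loop (fun v => v.fst.isSome || v.snd.isSome) compareBody)
        (v, stk i a (popped u b) (popped w c) n) s (v', stk i a b c n) := by
  induction u generalizing v w with
  | nil =>
    induction w generalizing v with
    | nil => exact ⟨v, _, by simp, le_of_eq (by simp), Exec.loop_false (by simp [hu, hw])⟩
    | cons y w ih =>
      obtain ⟨v', s, h, hs, e⟩ := ih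
        { v with flag := v.flag && decide (v.fst = v.snd), snd := w.head? } hu rfl
      refine ⟨v', _, ?_, ?_, Exec.loop_true (by simp [hw]) ((Exec.load _ _ _).seq
        ((Exec.ite_false (by simp [hu]) (Exec.load _ _ _)).seq
          (Exec.ite_true (by simp [hw]) (exec_popC w _)))) e⟩
      · rw [h]; simp [hu, hw]
      · simp only [List.length_cons]; omega
  | cons x u ih =>
    cases w with
    | nil =>
      obtain ⟨v', s, h, hs, e⟩ := ih []
        { v with flag := v.flag && decide (v.fst = v.snd), fst := u.head? } rfl hw
      refine ⟨v', _, ?_, ?_, Exec.loop_true (by simp [hu]) ((Exec.load _ _ _).seq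
        ((Exec.ite_true (by simp [hu]) (exec_popB u _)).seq
          (Exec.ite_false (by simp [hw]) (Exec.load _ _ _)))) e⟩
      · rw [h]; simp [hu, hw]
      · simp only [List.length_cons]; omega
    | cons y w =>
      obtain ⟨v', s, h, hs, e⟩ := ih w
        { v with flag := v.flag && decide (v.fst = v.snd), fst := u.head?, snd := w.head? } rfl rfl
      refine ⟨v', _, ?_, ?_, Exec.loop_true (by simp [hu]) ((Exec.load _ _ _).seq
        ((Exec.ite_true (by simp [hu]) (exec_popB u _)).seq
          (Exec.ite_true (by simp [hw]) (exec_popC w _)))) e⟩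
      · rw [h]; simp [hu, hw, Bool.and_assoc]
      · simp only [List.length_cons]; omega

theorem runs_compareTops (u w : List Bool) :
    Runs compareTops (stk i a (saved u (none :: b)) (saved w (none :: c)) n)
      (6 * (u.length + w.length) + 8)
      (stk i ((if u = w then [true, false, false] else [false]) ++ a) b c n) := by
  intro v
  obtain ⟨v', s, h, hs, e⟩ := compare_loop (i := i) (a := a) (b := b) (c := c) (n := n)
    u.reverse w.reverse { v with flag := true, fst := u.reverse.head?, snd := w.reverse.head? }
    rfl rfl
  simp only [Bool.true_and, List.reverse_inj] at h
  simp only [List.length_reverse] at hs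
  have e' := fun Z t (hZ : Exec (.ite Mem.flag (.seq (pushA false) (.seq (pushA false)
      (pushA true))) (pushA false)) (v', stk i a b c n) t Z) =>
    (Exec.load (fun v => { v with flag := true }) v _).seq ((exec_popB u.reverse _).seq
      ((exec_popC w.reverse _).seq (e.seq hZ)))
  by_cases huw : u = w
  · rw [if_pos huw]
    exact ⟨_, _, by omega, e' _ _ (Exec.ite_true (by simp [h, huw])
      ((exec_push_a _ _).seq ((exec_push_a _ _).seq (exec_push_a _ _))))⟩
  · rw [if_neg huw]
    exact ⟨_, _, by omega, e' _ _ (Exec.ite_false (by simp [h, huw]) (exec_push_a _ _))⟩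

/-- The machine program for a functional program, which replaces the topmost tree by its image. -/
def Fn.compile : Fn → MProg X
  | .id => skip
  | .nil => .seq dropTop (pushA false)
  | .fst => .seq popValue (.ite Mem.sym (.seq saveB (.seq dropTop restoreB)) (pushA false))
  | .snd => .seq popValue (.ite Mem.sym dropTop (pushA false))
  | .eq => .seq popValue (.ite Mem.sym (.seq saveB (.seq saveC compareTops)) (pushA false))
  | .pair f g => .seq dupTop (.seq f.compile (.seq saveB (.seq g.compile
      (.seq restoreB (pushA true)))))
  | .comp g f => .seq f.compile g.compile
  | .ite c f g => .seq dupTop (.seq c.compile (.seq popValue (.ite Mem.sym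
      (.seq (pushA true) (.seq dropTop f.compile)) g.compile)))
  | .fold f => .seq popValue (.ite Mem.sym (.seq popValue (.loop Mem.sym (.seq
      (.seq saveC (.seq saveB (.seq restoreC (.seq (pushA true) (.seq f.compile restoreB)))))
      popValue))) (pushA false))

/-- The contents below the working area are arbitrary, because a program parks intermediate results
there while its subprograms run. The counter is empty before and after each subprogram. -/
theorem runs_compile (f : Fn) (t : T) (a : List Bool) (b c : List (Option Bool)) :
    Runs f.compile (stk i (t.word ++ a) b c []) (f.cost t)
      (stk i ((f.eval t).word ++ a) b c []) := by
  have hpos := t.size_pos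
  induction f generalizing t a b c with
  | id => exact runs_skip.mono hpos
  | nil =>
    refine ((runs_dropTop t).seq (runs_pushA false)).mono ?_
    simp only [Fn.cost]; omega
  | fst =>
    cases t with
    | nil => exact (runs_pop_ite_false (runs_pushA false)).mono (by simp [Fn.cost, T.size])
    | node l r =>
      have h := runs_pop_ite_true (q := pushA false) ((runs_saveB (i := i) (a := r.word ++ a) (b := b)
        (c := c) l).seq ((runs_dropTop r).seq (runs_restoreB i a b c [] l.word)))
      simp only [T.word, List.cons_append, List.append_assoc]
      refine h.mono ?_
      have := l.size_pos
      simp only [Fn.cost, T.size, T.length_word]; omega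
  | snd =>
    cases t with
    | nil => exact (runs_pop_ite_false (runs_pushA false)).mono (by simp [Fn.cost, T.size])
    | node l r =>
      simp only [T.word, List.cons_append, List.append_assoc]
      refine (runs_pop_ite_true (runs_dropTop l)).mono ?_
      have := l.size_pos
      simp only [Fn.cost, T.size]; omega
  | eq =>
    cases t with
    | nil => exact (runs_pop_ite_false (runs_pushA false)).mono (by simp [Fn.cost, T.size])
    | node l r =>
      have h := runs_pop_ite_true (q := pushA false) ((runs_saveB (i := i) (a := r.word ++ a) (b := b)
        (c := c) l).seq ((runs_saveC r).seq (runs_compareTops l.word r.word)))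
      have hw : (Fn.eval .eq (.node l r)).word =
          if l.word = r.word then [true, false, false] else [false] := by
        simp only [Fn.eval, T.word_injective.eq_iff]
        split_ifs <;> rfl
      rw [hw]
      simp only [T.word, List.cons_append, List.append_assoc]
      refine h.mono ?_
      have := l.size_pos
      simp only [Fn.cost, T.size, T.length_word]; omega
  | pair f g hf hg =>
    -- The image under `f` waits on the first auxiliary stack while `g` consumes the second copy of
    -- `t`; the symbol pushed at the end joins the two images to a node.
    have h := (runs_dupTop (i := i) (a := a) (b := b) (c := c) t).seq ((hf t (t.word ++ a) b c hpos).seq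
      ((runs_saveB (f.eval t)).seq ((hg t a _ c hpos).seq
        ((runs_restoreB i _ b c [] (f.eval t).word).seq (runs_pushA true)))))
    simp only [Fn.eval, T.word, List.cons_append, List.append_assoc]
    refine h.mono ?_
    have := (f.eval t).size_pos
    simp only [Fn.cost, T.length_word]; omega
  | comp g f hg hf => exact (hf t a b c hpos).seq (hg _ a b c (T.size_pos _))
  | ite co f g hc hf hg =>
    have h := fun Z u hZ => (runs_dupTop (i := i) (a := a) (b := b) (c := c) t).seq
      ((hc t (t.word ++ a) b c hpos).seq (S'' := Z) (t := u) (q := .seq popValue (.ite Mem.sym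
      (.seq (pushA true) (.seq dropTop f.compile)) g.compile)) hZ)
    have hs := (co.eval t).size_pos
    cases hco : co.eval t with
    | nil =>
      rw [hco] at h
      have := h _ _ (runs_pop_ite_false (hg t a b c hpos))
      simp only [Fn.eval, Fn.cost, hco, Fn.compile]
      refine this.mono ?_
      simp only [T.size]; omega
    | node x y =>
      rw [hco] at h
      have hd := runs_dropTop (i := i) (a := t.word ++ a) (b := b) (c := c) (.node x y)
      simp only [T.word, List.cons_append, List.append_assoc] at h hd
      have := h _ _ (runs_pop_ite_true ((runs_pushA true).seq (hd.seq (hf t a b c hpos))))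
      simp only [Fn.eval, Fn.cost, hco, Fn.compile]
      refine this.mono ?_
      simp only [T.size]; omega
  | fold f hf =>
    cases t with
    | nil => exact (runs_pop_ite_false (runs_pushA false)).mono (by simp [Fn.cost])
    | node l acc =>
      simp only [T.word, List.cons_append, List.append_assoc, Fn.cost]
      rw [add_comm]
      refine runs_pop_ite_true ?_
      clear hpos
      simp only [Fn.eval]
      induction l generalizing acc with
      | nil => exact runs_pop_loop_false.mono (by simp [Fn.foldCost])
      | node x l _ ih =>
        -- While the step is computed, the rest `l` of the list waits on the first auxiliary stack.
        have hf' := hf (.node x acc) a (saved l.word (none :: b)) c (T.size_pos _)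
        simp only [T.word, List.cons_append, List.append_assoc] at hf'
        have hb := ((runs_saveC (i := i) (a := l.word ++ (acc.word ++ a)) (b := b) (c := c) x).seq
          ((runs_saveB l).seq ((runs_restoreC i (acc.word ++ a) _ c [] x.word).seq
          ((runs_pushA true).seq (hf'.seq
            (runs_restoreB i _ b c [] l.word))))))
        simp only [T.word, List.cons_append, List.append_assoc]
        refine (runs_pop_loop_true hb (ih _)).mono ?_
        have := x.size_pos
        have := l.size_pos
        simp only [Fn.foldCost, T.size, T.length_word]; omega

end Compile

end StackProg

namespace StackProg

open Turing

/-! ### Machines that decide a language -/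

/-- A list of trees as a tree. -/
def T.ofList : List T → T
  | [] => .nil
  | a :: l => .node a (ofList l)

/-- A truth value as a tree. -/
def T.ofBool : Bool → T
  | false => .nil
  | true => .node .nil .nil

section Machine

variable {X : Type}

/-- Push a word on the stack of values. -/
def pushWord : List Bool → MProg X
  | [] => skip
  | x :: w => .seq (pushWord w) (pushA x)

theorem exec_pushWord (w : List Bool) (v : Mem X) (i : List X) (a : List Bool)
    (b c : List (Option Bool)) (n : List Unit) :
    Exec (pushWord w) (v, stk i a b c n) (w.length + 1) (v, stk i (w ++ a) b c n) := by
  induction w with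
  | nil => exact .load id v _
  | cons x w ih => exact ih.seq (exec_push_a _ v)

open Classical in
/-- Push the code of the symbol in the memory, if it belongs to a given list. -/
noncomputable def pushCode (e : X → T) : List X → MProg X
  | [] => skip
  | x :: l => .ite (fun v => decide (v.read = some x)) (pushWord (true :: (e x).word)) (pushCode e l)

theorem exec_pushCode (e : X → T) (l : List X) (x : X) (hx : x ∈ l) (v : Mem X)
    (hv : v.read = some x) (i : List X) (a : List Bool) (b c : List (Option Bool))
    (n : List Unit) : ∃ s, s ≤ l.length + (e x).size + 2 ∧
    Exec (pushCode e l) (v, stk i a b c n) s (v, stk i (true :: ((e x).word ++ a)) b c n) := by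
  induction l with
  | nil => simp at hx
  | cons y l ih =>
    by_cases hxy : x = y
    · subst hxy
      exact ⟨_, by simp only [List.length_cons, T.length_word]; omega,
        Exec.ite_true (by simp [hv]) (exec_pushWord (true :: (e x).word) v i a b c n)⟩
    · obtain ⟨s, hs, h⟩ := ih (by simpa [hxy] using hx)
      exact ⟨_, by simp only [List.length_cons]; omega, Exec.ite_false (by simp [hv, hxy]) h⟩

/-- Read one symbol of the input. -/
def readSym : MProg X := .pop Stk.inp fun v x => { v with read := x }

/-- Discard one symbol of the stack of values. -/
def discard : MProg X := .pop Stk.a fun v _ => v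

/-- Replace the tree of a truth value by one symbol. -/
def finish : MProg X :=
  .seq (.seq popValue (.ite Mem.sym (.seq discard (.seq discard (pushA true))) (pushA false)))
    (.load fun _ => Mem.init X)

theorem exec_finish (r : Bool) (v : Mem X) : ∃ s, s ≤ 10 ∧
    Exec finish (v, stk [] (T.ofBool r).word [] [] []) s
      (Mem.init X, stk [] [r] [] [] []) := by
  cases r
  · exact ⟨_, by norm_num, ((exec_pop_a _ _).seq (.ite_false rfl (exec_push_a _ _))).seq
      (.load _ _ _)⟩
  · exact ⟨_, by norm_num, ((exec_pop_a _ _).seq (.ite_true rfl ((exec_pop_a _ _).seq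
      ((exec_pop_a _ _).seq (exec_push_a _ _))))).seq (.load _ _ _)⟩

variable [Fintype X]

/-- Transform the input word into a tree. -/
noncomputable def loadInput (e : X → T) : MProg X :=
  .seq (pushA false) (.seq readSym (.loop (fun v => v.read.isSome)
    (.seq (pushCode e Finset.univ.toList) readSym)))

theorem loadInput_loop (e : X → T) (N : ℕ) (hN : ∀ x, (e x).size ≤ N) (w : List X) (v : Mem X)
    (hv : v.read = w.head?) (t : T) : ∃ v' s, s ≤ (Fintype.card X + N + 4) * w.length + 1 ∧
    Exec (.loop (fun v => v.read.isSome) (.seq (pushCode e Finset.univ.toList) readSym))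
      (v, stk w.tail t.word [] [] []) s
      (v', stk [] (((w.map e).foldl (fun acc x => .node x acc) t)).word [] [] []) := by
  induction w generalizing v t with
  | nil => exact ⟨v, 1, by simp, Exec.loop_false (by simp [hv])⟩
  | cons x w ih =>
    obtain ⟨s, hs, h⟩ := exec_pushCode e Finset.univ.toList x (by simp) v hv w t.word [] [] []
    obtain ⟨v', s', hs', h'⟩ := ih { v with read := w.head? } rfl (.node (e x) t)
    refine ⟨v', _, ?_, Exec.loop_true (by simp [hv]) (h.seq (exec_pop_inp _ _)) h'⟩
    have := hN x
    simp only [Finset.length_toList, Finset.card_univ] at hs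
    simp only [List.length_cons, mul_add, mul_one]
    omega

theorem foldl_node (l : List T) (t : List T) :
    l.foldl (fun acc x => .node x acc) (T.ofList t) = T.ofList (l.reverse ++ t) := by
  induction l generalizing t with
  | nil => rfl
  | cons x l ih =>
    rw [List.foldl_cons, List.reverse_cons, List.append_assoc]
    exact ih (x :: t)

theorem runs_loadInput (e : X → T) (N : ℕ) (hN : ∀ x, (e x).size ≤ N) (w : List X) :
    Runs (loadInput e) (stk w [] [] [] []) ((Fintype.card X + N + 4) * w.length + 3)
      (stk [] (T.ofList (w.map e).reverse).word [] [] []) := by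
  intro v
  obtain ⟨v', s, hs, h⟩ := loadInput_loop e N hN w { v with read := w.head? } rfl .nil
  rw [show T.nil = T.ofList [] from rfl, foldl_node, List.append_nil] at h
  exact ⟨v', _, by omega, (exec_push_a _ _).seq ((exec_pop_inp _ _).seq h)⟩

/-- The whole program of a machine. -/
noncomputable def wholeProg (e : X → T) (f : Fn) : MProg X :=
  .seq (.seq (loadInput e) f.compile) finish

/-- The machine of a program. -/
noncomputable def machine (e : X → T) (f : Fn) : TM2ComputableAux X Bool where
  tm :=
    { K := Stk
      k₀ := .inp
      k₁ := .a
      Γ := Alph X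
      Λ := Option (wholeProg e f).Lab
      main := some (wholeProg e f).entry
      ΛFin := letI := (wholeProg e f).labFintype; inferInstance
      σ := Mem X
      initialState := Mem.init X
      Γk₀Fin := inferInstanceAs (Fintype X)
      m := fun l => match l with
        | none => .halt
        | some l => (wholeProg e f).code some none l }
  inputAlphabet := Equiv.refl X
  outputAlphabet := Equiv.refl Bool

/-- The program receives the reverse of the input, since each symbol read is put in front of the
list built so far. The constant covers the reading, which depends on the number of symbols and their
largest code, and the final clean-up. -/
theorem machine_outputs (e : X → T) (f : Fn) : ∃ C, ∀ (w : List X) (r : Bool),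
    f.eval (T.ofList (w.map e).reverse) = T.ofBool r →
    Nonempty (TM2OutputsInTime (machine e f).tm (w.map (machine e f).inputAlphabet.symm)
      (some ([r].map (machine e f).outputAlphabet.symm))
      (C * (w.length + 1) + f.cost (T.ofList (w.map e).reverse))) := by
  obtain ⟨N, hN⟩ : ∃ N, ∀ x, (e x).size ≤ N :=
    ⟨Finset.univ.sup fun x => (e x).size, fun x =>
      Finset.le_sup (f := fun x => (e x).size) (Finset.mem_univ x)⟩
  refine ⟨Fintype.card X + N + 18, fun w r hr => ?_⟩
  have hc := runs_compile (i := ([] : List X)) f (T.ofList (w.map e).reverse) [] [] []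
  rw [hr, List.append_nil, List.append_nil] at hc
  obtain ⟨v₁, s₁, hs₁, e₁⟩ := ((runs_loadInput e N hN w).seq hc) (Mem.init X)
  obtain ⟨s₂, hs₂, e₂⟩ := exec_finish r v₁
  have h := (e₁.seq e₂).stepsTo (p := wholeProg e f) (machine e f).tm.m some none fun _ => rfl
  -- One more step executes the halt statement; the memory has been reset because a halting
  -- configuration must carry the initial state.
  have h' : StepsTo (machine e f).tm.m ⟨some none, Mem.init X, stk [] [r] [] [] []⟩ 1
      ⟨none, Mem.init X, stk [] [r] [] [] []⟩ := .single rfl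
  refine ⟨⟨⟨s₁ + s₂ + 1, ?_⟩, ?_⟩⟩
  · have hi : initList (machine e f).tm (w.map (machine e f).inputAlphabet.symm) =
        ⟨some (some (wholeProg e f).entry), Mem.init X, stk w [] [] [] []⟩ := by
      have hw : w.map (machine e f).inputAlphabet.symm = w := List.map_id w
      rw [hw]
      unfold initList
      congr 1
      funext k
      cases k <;> rfl
    have ho : haltList (machine e f).tm ([r].map (machine e f).outputAlphabet.symm) =
        ⟨none, Mem.init X, stk [] [r] [] [] []⟩ := by
      unfold haltList
      congr 1
      funext k
      cases k <;> rfl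
    rw [hi, Option.map_some, ho]
    exact h.trans h'
  · have : (Fintype.card X + N + 18) * (w.length + 1) = (Fintype.card X + N + 4) * w.length +
      (Fintype.card X + N) + 18 + 14 * w.length := by ring
    change s₁ + s₂ + 1 ≤ _
    omega

end Machine

end StackProg

namespace StackProg

/-! ### Polynomial-time functions between encoded types -/

/-- Types whose elements are encoded as trees. -/
class Enc (α : Type) where
  enc : α → T
  inj : Function.Injective enc

open Enc

/-- The size of the encoding. -/
def sz {α : Type} [Enc α] (a : α) : ℕ := (enc a).size

theorem sz_pos {α : Type} [Enc α] (a : α) : 1 ≤ sz a := (enc a).size_pos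

theorem T.ofList_injective : Function.Injective T.ofList := by
  intro l
  induction l with
  | nil => intro l' h; cases l' <;> simp_all [T.ofList]
  | cons a l ih =>
    intro l' h
    cases l' with
    | nil => simp [T.ofList] at h
    | cons b l' =>
      simp only [T.ofList, T.node.injEq] at h
      rw [h.1, ih h.2]

instance : Enc T := ⟨id, Function.injective_id⟩

instance : Enc Unit := ⟨fun _ => .nil, fun _ _ _ => rfl⟩

instance : Enc Bool := ⟨T.ofBool, fun a b h => by cases a <;> cases b <;> simp_all [T.ofBool]⟩

/-- Numbers are unary inside the programs, so polynomial means polynomial in their value. -/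
instance : Enc ℕ := ⟨fun n => T.ofList (List.replicate n .nil), fun m n h => by
  simpa using congrArg List.length (T.ofList_injective h)⟩

instance {α β : Type} [Enc α] [Enc β] : Enc (α × β) :=
  ⟨fun p => .node (enc p.1) (enc p.2), fun p q h => by
    simp only [T.node.injEq] at h
    exact Prod.ext (inj h.1) (inj h.2)⟩

instance {α : Type} [Enc α] : Enc (List α) :=
  ⟨fun l => T.ofList (l.map enc), fun _ _ h => List.map_injective_iff.2 inj (T.ofList_injective h)⟩

section

variable {α β γ δ : Type} [Enc α] [Enc β] [Enc γ] [Enc δ]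

theorem sz_pair (a : α) (b : β) : sz (a, b) = 1 + sz a + sz b := rfl

theorem sz_nil : sz ([] : List α) = 1 := rfl

theorem sz_cons (a : α) (l : List α) : sz (a :: l) = 1 + sz a + sz l := rfl

theorem sz_tail_le (l : List α) : sz l.tail ≤ sz l := by
  cases l with
  | nil => exact le_rfl
  | cons a l => simp only [List.tail_cons, sz_cons]; omega

theorem sz_append (l l' : List α) : sz (l ++ l') + 1 = sz l + sz l' := by
  induction l with
  | nil => simp [sz_nil]; omega
  | cons a l ih => simp only [List.cons_append, sz_cons]; omega

theorem sz_le_of_mem {a : α} {l : List α} (h : a ∈ l) : sz a ≤ sz l := by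
  induction l with
  | nil => simp at h
  | cons b l ih =>
    simp only [sz_cons]
    rcases List.mem_cons.1 h with rfl | h
    · omega
    · have := ih h; omega

theorem length_le_sz (l : List α) : l.length ≤ sz l := by
  induction l with
  | nil => simp
  | cons a l ih => simp only [sz_cons, List.length_cons]; omega

theorem sz_le_of_sublist {l l' : List α} (h : l.Sublist l') : sz l ≤ sz l' := by
  induction h with
  | slnil => exact le_rfl
  | cons a _ ih => simp only [sz_cons]; omega
  | cons_cons a _ ih => simp only [sz_cons]; omega

theorem sz_list_le {l : List α} {B : ℕ} (h : ∀ a ∈ l, sz a ≤ B) :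
    sz l ≤ 1 + l.length * (B + 1) := by
  induction l with
  | nil => simp [sz_nil]
  | cons a l ih =>
    have h1 := h a (by simp)
    have h2 := ih fun b hb => h b (by simp [hb])
    simp only [sz_cons, List.length_cons, add_mul, one_mul]
    omega

theorem sz_bool (b : Bool) : sz b ≤ 3 := by cases b <;> simp [sz, enc, T.ofBool, T.size]

theorem sz_nat (n : ℕ) : sz n = 2 * n + 1 := by
  induction n with
  | zero => rfl
  | succ n ih =>
    have : sz (n + 1) = 1 + 1 + sz n := rfl
    omega

/-- Functions into the natural numbers that are bounded by a polynomial in the size. -/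
def PolyBdd (n : α → ℕ) : Prop := ∃ d, ∀ a, n a ≤ (sz a + 1) ^ d

theorem PolyBdd.mono {m n : α → ℕ} (hn : PolyBdd n) (h : ∀ a, m a ≤ n a) : PolyBdd m :=
  let ⟨d, hd⟩ := hn
  ⟨d, fun a => (h a).trans (hd a)⟩

theorem PolyBdd.const (k : ℕ) : PolyBdd fun _ : α => k :=
  ⟨k, fun a => (Nat.lt_two_pow_self).le.trans (Nat.pow_le_pow_left (by have := sz_pos a; omega) k)⟩

theorem PolyBdd.size : PolyBdd fun a : α => sz a := ⟨1, fun a => by simp⟩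

theorem PolyBdd.mul {m n : α → ℕ} (hm : PolyBdd m) (hn : PolyBdd n) :
    PolyBdd fun a => m a * n a := by
  obtain ⟨d, hd⟩ := hm
  obtain ⟨e, he⟩ := hn
  exact ⟨d + e, fun a => by rw [pow_add]; exact Nat.mul_le_mul (hd a) (he a)⟩

theorem PolyBdd.add {m n : α → ℕ} (hm : PolyBdd m) (hn : PolyBdd n) :
    PolyBdd fun a => m a + n a := by
  obtain ⟨d, hd⟩ := hm
  obtain ⟨e, he⟩ := hn
  refine ⟨d + e + 1, fun a => ?_⟩
  -- The base is at least two, so raising the exponent by one absorbs the factor two from the sum.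
  have h1 : 2 ≤ sz a + 1 := by have := sz_pos a; omega
  have h2 : (sz a + 1) ^ d ≤ (sz a + 1) ^ (d + e) := Nat.pow_le_pow_right (by omega) (by omega)
  have h3 : (sz a + 1) ^ e ≤ (sz a + 1) ^ (d + e) := Nat.pow_le_pow_right (by omega) (by omega)
  calc m a + n a ≤ (sz a + 1) ^ (d + e) * 2 := by have := hd a; have := he a; omega
    _ ≤ (sz a + 1) ^ (d + e + 1) := by rw [pow_succ]; exact Nat.mul_le_mul_left _ h1

theorem PolyBdd.pow {m : α → ℕ} (hm : PolyBdd m) (k : ℕ) : PolyBdd fun a => m a ^ k := by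
  obtain ⟨d, hd⟩ := hm
  exact ⟨d * k, fun a => by rw [pow_mul]; exact Nat.pow_le_pow_left (hd a) k⟩

theorem PolyBdd.comp {n : β → ℕ} (hn : PolyBdd n) {f : α → β}
    (hf : PolyBdd fun a => sz (f a)) : PolyBdd fun a => n (f a) := by
  obtain ⟨d, hd⟩ := hn
  exact ((hf.add (.const 1)).pow d).mono fun a => hd (f a)

/-- Functions that are computed by a program in polynomial time. -/
def Poly (f : α → β) : Prop :=
  ∃ c : Fn, (∀ a, c.eval (enc a) = enc (f a)) ∧ PolyBdd fun a : α => c.cost (enc a)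

theorem Poly.polyBdd_sz {f : α → β} (hf : Poly f) : PolyBdd fun a => sz (f a) := by
  obtain ⟨c, hc, hb⟩ := hf
  exact hb.mono fun a => by rw [sz, ← hc]; exact c.size_eval_le _

theorem Poly.of_enc_eq {f : α → β} (h : ∀ a, enc (f a) = enc a) : Poly f :=
  ⟨.id, fun a => (h a).symm, PolyBdd.size⟩

theorem Poly.of_eq {f g : α → β} (hf : Poly f) (h : ∀ a, f a = g a) : Poly g :=
  (funext h : f = g) ▸ hf

theorem Poly.id : Poly fun a : α => a := .of_enc_eq fun _ => rfl

theorem Poly.comp {g : β → γ} {f : α → β} (hg : Poly g) (hf : Poly f) : Poly fun a => g (f a) := by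
  have hs := hf.polyBdd_sz
  obtain ⟨c, hc, hb⟩ := hf
  obtain ⟨c', hc', hb'⟩ := hg
  exact ⟨.comp c' c, fun a => by simp only [Fn.eval, hc, hc'],
    (hb.add (hb'.comp hs)).mono fun a => by simp only [Fn.cost, hc]; exact le_rfl⟩

theorem Poly.pair {f : α → β} {g : α → γ} (hf : Poly f) (hg : Poly g) :
    Poly fun a => (f a, g a) := by
  have hs := hf.polyBdd_sz
  obtain ⟨c, hc, hb⟩ := hf
  obtain ⟨c', hc', hb'⟩ := hg
  refine ⟨.pair c c', fun a => by simp only [Fn.eval, hc, hc']; rfl, (((hb.add hb').add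
    ((PolyBdd.const 60).mul PolyBdd.size)).add ((PolyBdd.const 60).mul hs)).mono fun a => ?_⟩
  simp only [Fn.cost, hc]; exact le_rfl

theorem Poly.fst : Poly (Prod.fst : α × β → α) :=
  ⟨.fst, fun _ => rfl, ((PolyBdd.const 60).mul PolyBdd.size).mono fun _ => le_rfl⟩

theorem Poly.snd : Poly (Prod.snd : α × β → β) :=
  ⟨.snd, fun _ => rfl, ((PolyBdd.const 60).mul PolyBdd.size).mono fun _ => le_rfl⟩

theorem Poly.const (b : β) : Poly fun _ : α => b := by
  have key : ∀ t : T, Poly fun _ : α => t := by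
    intro t
    induction t with
    | nil => exact ⟨.nil, fun _ => rfl, ((PolyBdd.const 60).mul PolyBdd.size).mono fun _ => le_rfl⟩
    | node l r hl hr =>
      obtain ⟨c, hc, hb⟩ := hl.pair hr
      exact ⟨c, hc, hb⟩
  obtain ⟨c, hc, hb⟩ := key (enc b)
  exact ⟨c, hc, hb⟩

theorem Poly.ite {c : α → Bool} {f g : α → β} (hc : Poly c) (hf : Poly f) (hg : Poly g) :
    Poly fun a => if c a then f a else g a := by
  have hs := hc.polyBdd_sz
  obtain ⟨p, hp, hb⟩ := hc
  obtain ⟨q, hq, hb'⟩ := hf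
  obtain ⟨r, hr, hb''⟩ := hg
  refine ⟨.ite p q r, fun a => ?_, ((((hb.add ((PolyBdd.const 60).mul PolyBdd.size)).add
    ((PolyBdd.const 60).mul hs)).add hb').add hb'').mono fun a => ?_⟩
  · simp only [Fn.eval, hp]
    cases c a
    · simpa [enc, T.ofBool] using hr a
    · simpa [enc, T.ofBool] using hq a
  · simp only [Fn.cost, hp]
    change _ + 60 * sz a + 60 * sz (c a) + _ ≤ _
    cases c a <;> simp only [enc, T.ofBool] <;> omega

theorem Poly.eq [DecidableEq β] {f g : α → β} (hf : Poly f) (hg : Poly g) :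
    Poly fun a => decide (f a = g a) := by
  have : Poly fun p : β × β => decide (p.1 = p.2) := by
    refine ⟨.eq, fun p => ?_, ((PolyBdd.const 60).mul PolyBdd.size).mono fun _ => le_rfl⟩
    change (if enc p.1 = enc p.2 then T.node .nil .nil else .nil) = T.ofBool _
    by_cases h : p.1 = p.2
    · simp [h, T.ofBool]
    · simp [h, T.ofBool, inj.eq_iff]
  exact this.comp (hf.pair hg)

theorem Poly.not {p : α → Bool} (hp : Poly p) : Poly fun a => !p a :=
  (hp.ite (.const false) (.const true)).of_eq fun a => by cases p a <;> rfl

theorem Poly.and {p q : α → Bool} (hp : Poly p) (hq : Poly q) : Poly fun a => p a && q a :=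
  (hp.ite hq (.const false)).of_eq fun a => by cases p a <;> rfl

theorem Poly.or {p q : α → Bool} (hp : Poly p) (hq : Poly q) : Poly fun a => p a || q a :=
  (hp.ite (.const true) hq).of_eq fun a => by cases p a <;> rfl

/-! ### Lists -/

theorem Poly.cons {f : α → β} {l : α → List β} (hf : Poly f) (hl : Poly l) :
    Poly fun a => f a :: l a := by
  obtain ⟨c, hc, hb⟩ := hf.pair hl
  exact ⟨c, hc, hb⟩

theorem Poly.tail {l : α → List β} (hl : Poly l) : Poly fun a => (l a).tail := by
  have : Poly fun l : List β => l.tail := by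
    refine ⟨.snd, fun l => ?_, ((PolyBdd.const 60).mul PolyBdd.size).mono fun _ => le_rfl⟩
    cases l <;> rfl
  exact this.comp hl

theorem Poly.isEmpty {l : α → List β} (hl : Poly l) : Poly fun a => (l a).isEmpty := by
  have : Poly fun l : List β => l.isEmpty := by
    obtain ⟨c, hc, hb⟩ := Poly.const (α := List β) true
    obtain ⟨c', hc', hb'⟩ := Poly.const (α := List β) false
    refine ⟨.ite .id c' c, fun l => ?_, ((((PolyBdd.const 121).mul PolyBdd.size).add hb).add
      hb').mono fun l => ?_⟩
    · have h1 := hc l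
      have h2 := hc' l
      cases l
      · exact h1
      · exact h2
    · simp only [Fn.cost, Fn.eval]
      change sz l + 60 * sz l + 60 * sz l + _ ≤ _
      cases enc l <;> simp only <;> omega
  exact this.comp hl

theorem Poly.headD {l : α → List β} (hl : Poly l) (d : β) : Poly fun a => (l a).headD d := by
  -- The values are taken in `T`, because on the empty list the projection in the other branch need
  -- not encode an element of `β`.
  have : Poly fun l : List β => (if l.isEmpty then enc d else match enc l with
      | .nil => .nil
      | .node x _ => x : T) := by
    refine (Poly.id.isEmpty).ite (.const _) ⟨.fst, fun l => ?_, ((PolyBdd.const 60).mul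
      PolyBdd.size).mono fun _ => le_rfl⟩
    rfl
  obtain ⟨c, hc, hb⟩ := this
  refine Poly.comp (g := fun l : List β => l.headD d) ⟨c, fun l => ?_, hb⟩ hl
  rw [hc]
  cases l <;> rfl

/-- The time for folding an encoded list, for a step that keeps a context. -/
theorem foldCost_le {h : γ → β → α → β} {s : Fn} {x : γ} {K M : ℕ}
    (hs : ∀ acc a, s.eval (.node (enc a) (.node (enc x) (enc acc))) =
      .node (enc x) (enc (h x acc a)))
    (l : List α) (acc : β)
    (hK : ∀ l' a l'', l = l' ++ a :: l'' →
      s.cost (.node (enc a) (.node (enc x) (enc (l'.foldl (h x) acc)))) + 60 * sz l ≤ K)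
    (hM : 3 + sz x + sz (l.foldl (h x) acc) ≤ M) :
    (enc l).foldl s.eval (.node (enc x) (enc acc)) = .node (enc x) (enc (l.foldl (h x) acc)) ∧
    Fn.foldCost s.eval s.cost (enc l) (.node (enc x) (enc acc)) ≤ l.length * K + M := by
  induction l generalizing acc with
  | nil =>
    refine ⟨rfl, ?_⟩
    change 1 + sz x + sz acc + 2 ≤ _
    simp only [List.foldl_nil] at hM
    omega
  | cons a l ih =>
    have h1 := hK [] a l rfl
    obtain ⟨h2, h3⟩ := ih (h x acc a) (fun l' b l'' hl => by
      have := hK (a :: l') b l'' (by simp [hl])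
      simp only [List.foldl_cons, sz_cons] at this
      omega) hM
    constructor
    · change T.foldl s.eval (enc l) (s.eval (.node (enc a) (.node (enc x) (enc acc)))) = _
      rw [hs, h2]; rfl
    · change s.cost (.node (enc a) (.node (enc x) (enc acc))) + 60 * sz (a :: l) +
        Fn.foldCost s.eval s.cost (enc l) (s.eval (.node (enc a) (.node (enc x) (enc acc)))) ≤ _
      rw [hs]
      simp only [List.foldl_nil] at h1
      simp only [List.length_cons, add_mul, one_mul]
      omega

/-- Folding is possible in polynomial time, as long as each step increases the size at most by a
polynomial in the size of the context. -/
theorem Poly.foldl {l : γ → List α} {g : γ → β} {h : γ → β → α → β} (hl : Poly l) (hg : Poly g)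
    (hh : Poly fun p : γ × β × α => h p.1 p.2.1 p.2.2) (I : γ → β → Prop) (B : γ → ℕ)
    (hB : PolyBdd B) (h0 : ∀ x, I x (g x))
    (h1 : ∀ x acc a, a ∈ l x → I x acc → I x (h x acc a) ∧ sz (h x acc a) ≤ sz acc + B x) :
    Poly fun x => (l x).foldl (h x) (g x) := by
  have hlen : PolyBdd fun x => (l x).length := hl.polyBdd_sz.mono fun x => length_le_sz _
  -- All intermediate accumulators are bounded, not only the last one, since each of them is the
  -- input of a step.
  have hsz : ∀ x (l' l'' : List α), l x = l' ++ l'' →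
      I x (l'.foldl (h x) (g x)) ∧ sz (l'.foldl (h x) (g x)) ≤ sz (g x) + (l x).length * B x := by
    intro x l' l'' hl'
    have : I x (l'.foldl (h x) (g x)) ∧
        sz (l'.foldl (h x) (g x)) ≤ sz (g x) + l'.length * B x := by
      induction l' using List.reverseRecOn generalizing l'' with
      | nil => exact ⟨h0 x, by simp⟩
      | append_singleton l' a ih =>
        obtain ⟨i1, i2⟩ := ih (a :: l'') (by simp [hl'])
        obtain ⟨i3, i4⟩ := h1 x _ a (by simp [hl']) i1
        simp only [List.foldl_append, List.foldl_cons, List.foldl_nil, List.length_append,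
          List.length_singleton, add_mul, one_mul]
        exact ⟨i3, by omega⟩
    refine ⟨this.1, this.2.trans ?_⟩
    have : l'.length ≤ (l x).length := by simp [hl']
    gcongr
  have hacc : PolyBdd fun x => sz (g x) + (l x).length * B x := hg.polyBdd_sz.add (hlen.mul hB)
  -- A folded program sees only the element and the accumulator, so the context `x` travels inside
  -- the accumulator; the final `.snd` removes it.
  have hstep : Poly fun p : α × γ × β => (p.2.1, h p.2.1 p.2.2 p.1) :=
    (Poly.fst.comp Poly.snd).pair (hh.comp ((Poly.fst.comp Poly.snd).pair
      ((Poly.snd.comp Poly.snd).pair Poly.fst)))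
  obtain ⟨s, hs, d, hd⟩ := hstep
  obtain ⟨c, hc, hb⟩ := hl.pair (Poly.id.pair hg)
  have key := fun x => foldCost_le (h := h) (s := s) (x := x)
    (K := (1 + sz (l x) + (1 + sz x + (sz (g x) + (l x).length * B x)) + 1) ^ d + 60 * sz (l x))
    (M := 3 + sz x + (sz (g x) + (l x).length * B x)) (fun acc a => hs (a, x, acc)) (l x) (g x)
    (fun l' a l'' hl' => by
      have h1 := (hsz x l' _ hl').2
      have h2 := hd (a, x, l'.foldl (h x) (g x))
      have h3 : sz a ≤ sz (l x) := sz_le_of_mem (by simp [hl'])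
      simp only [sz_pair] at h2
      refine Nat.add_le_add_right (h2.trans (Nat.pow_le_pow_left ?_ d)) _
      omega)
    (by have := (hsz x (l x) [] (by simp)).2; omega)
  refine ⟨.comp .snd (.comp (.fold s) c), fun x => ?_, ((hb.add ((((hlen.mul
    ((((((PolyBdd.const 1).add hl.polyBdd_sz).add (((PolyBdd.const 1).add PolyBdd.size).add hacc)).add
    (.const 1)).pow d).add ((PolyBdd.const 60).mul hl.polyBdd_sz))).add
    (((PolyBdd.const 3).add PolyBdd.size).add hacc))).add (.const 3))).add ((PolyBdd.const 60).mul
    (((PolyBdd.const 1).add PolyBdd.size).add hacc))).mono fun x => ?_⟩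
  · simp only [Fn.eval, hc]
    change Fn.eval .snd (T.foldl s.eval (enc (l x)) (.node (enc x) (enc (g x)))) = _
    rw [(key x).1]; rfl
  · simp only [Fn.cost, hc, Fn.eval]
    change c.cost (enc x) + (2 + Fn.foldCost s.eval s.cost (enc (l x)) (.node (enc x) (enc (g x)))) +
      60 * (T.foldl s.eval (enc (l x)) (.node (enc x) (enc (g x)))).size ≤ _
    rw [(key x).1]
    have h1 := (key x).2
    have h2 := (hsz x (l x) [] (by simp)).2
    change c.cost (enc x) + (2 + Fn.foldCost s.eval s.cost (enc (l x)) (.node (enc x) (enc (g x)))) +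
      60 * (1 + sz x + sz ((l x).foldl (h x) (g x))) ≤ _
    generalize Fn.foldCost s.eval s.cost (enc (l x)) (.node (enc x) (enc (g x))) = F at h1 ⊢
    omega

end

end StackProg

namespace StackProg

open Enc

variable {α β γ δ : Type} [Enc α] [Enc β] [Enc γ] [Enc δ]

theorem Poly.exists_bound {l : γ → List α} {h : γ → α → β} (hl : Poly l)
    (hh : Poly fun p : γ × α => h p.1 p.2) :
    ∃ B : γ → ℕ, PolyBdd B ∧ ∀ x, ∀ a ∈ l x, sz (h x a) ≤ B x := by
  obtain ⟨d, hd⟩ := hh.polyBdd_sz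
  refine ⟨fun x => (1 + sz x + sz (l x) + 1) ^ d, (((((PolyBdd.const 1).add .size).add
    hl.polyBdd_sz).add (.const 1)).pow d), fun x a ha => (hd (x, a)).trans ?_⟩
  have := sz_le_of_mem ha
  rw [sz_pair]
  exact Nat.pow_le_pow_left (by omega) d

theorem Poly.reverse {l : γ → List α} (hl : Poly l) : Poly fun x => (l x).reverse := by
  have h := Poly.foldl (g := fun _ => ([] : List α)) (h := fun _ acc a => a :: acc) hl (.const _)
    ((Poly.snd.comp Poly.snd).cons (Poly.fst.comp Poly.snd)) (fun _ _ => True)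
    (fun x => 1 + sz (l x)) ((PolyBdd.const 1).add hl.polyBdd_sz) (fun _ => trivial)
    (fun x acc a ha _ => ⟨trivial, by have := sz_le_of_mem ha; rw [sz_cons]; omega⟩)
  refine h.of_eq fun x => ?_
  have : ∀ l acc : List α, l.foldl (fun acc a => a :: acc) acc = l.reverse ++ acc := by
    intro l
    induction l with
    | nil => simp
    | cons a l ih => intro acc; simp [ih]
  rw [this, List.append_nil]

theorem Poly.foldr {l : γ → List α} {g : γ → β} {h : γ → α → β → β} (hl : Poly l) (hg : Poly g)
    (hh : Poly fun p : γ × α × β => h p.1 p.2.1 p.2.2) (I : γ → β → Prop) (B : γ → ℕ)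
    (hB : PolyBdd B) (h0 : ∀ x, I x (g x))
    (h1 : ∀ x acc a, a ∈ l x → I x acc → I x (h x a acc) ∧ sz (h x a acc) ≤ sz acc + B x) :
    Poly fun x => (l x).foldr (h x) (g x) :=
  (Poly.foldl (h := fun x acc a => h x a acc) hl.reverse hg
    (hh.comp (Poly.fst.pair ((Poly.snd.comp .snd).pair (Poly.fst.comp .snd)))) I B hB h0
    fun x acc a ha => h1 x acc a (by simpa using ha)).of_eq fun x => by simp

theorem Poly.append {l l' : γ → List α} (hl : Poly l) (hl' : Poly l') :
    Poly fun x => l x ++ l' x :=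
  (Poly.foldr (h := fun _ a acc => a :: acc) hl hl' ((Poly.fst.comp .snd).cons
    (Poly.snd.comp .snd)) (fun _ _ => True) (fun x => 1 + sz (l x))
    ((PolyBdd.const 1).add hl.polyBdd_sz) (fun _ => trivial)
    (fun x acc a ha _ => ⟨trivial, by have := sz_le_of_mem ha; rw [sz_cons]; omega⟩)).of_eq
    fun x => by simp

theorem Poly.map {l : γ → List α} {h : γ → α → β} (hl : Poly l)
    (hh : Poly fun p : γ × α => h p.1 p.2) : Poly fun x => (l x).map (h x) := by
  obtain ⟨B, hB, hB'⟩ := Poly.exists_bound hl hh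
  refine (Poly.foldr (g := fun _ => []) (h := fun x a acc => h x a :: acc) hl (.const _)
    ((hh.comp (Poly.fst.pair (Poly.fst.comp .snd))).cons (Poly.snd.comp .snd)) (fun _ _ => True)
    (fun x => 1 + B x) ((PolyBdd.const 1).add hB) (fun _ => trivial)
    (fun x acc a ha _ => ⟨trivial, by have := hB' x a ha; rw [sz_cons]; omega⟩)).of_eq fun x => ?_
  simp

theorem Poly.filter {l : γ → List α} {p : γ → α → Bool} (hl : Poly l)
    (hp : Poly fun x : γ × α => p x.1 x.2) : Poly fun x => (l x).filter (p x) := by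
  refine (Poly.foldr (g := fun _ => []) (h := fun x a acc => if p x a then a :: acc else acc) hl
    (.const _) ((hp.comp (Poly.fst.pair (Poly.fst.comp .snd))).ite
    ((Poly.fst.comp .snd).cons (Poly.snd.comp .snd)) (Poly.snd.comp .snd)) (fun _ _ => True)
    (fun x => 1 + sz (l x)) ((PolyBdd.const 1).add hl.polyBdd_sz) (fun _ => trivial)
    (fun x acc a ha _ => ⟨trivial, ?_⟩)).of_eq fun x => ?_
  · have := sz_le_of_mem ha
    split_ifs
    · rw [sz_cons]; omega
    · omega
  · induction l x with
    | nil => rfl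
    | cons a l ih => rw [List.foldr_cons, ih, List.filter_cons]

theorem Poly.any {l : γ → List α} {p : γ → α → Bool} (hl : Poly l)
    (hp : Poly fun x : γ × α => p x.1 x.2) : Poly fun x => (l x).any (p x) := by
  refine (Poly.foldr (g := fun _ => false) (h := fun x a acc => p x a || acc) hl
    (.const _) ((hp.comp (Poly.fst.pair (Poly.fst.comp .snd))).or (Poly.snd.comp .snd))
    (fun _ _ => True) (fun _ => 3) (.const 3) (fun _ => trivial)
    (fun x acc a _ _ => ⟨trivial, by have := sz_bool (p x a || acc); omega⟩)).of_eq fun x => ?_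
  induction l x with
  | nil => rfl
  | cons a l ih => rw [List.foldr_cons, ih, List.any_cons]

theorem Poly.all {l : γ → List α} {p : γ → α → Bool} (hl : Poly l)
    (hp : Poly fun x : γ × α => p x.1 x.2) : Poly fun x => (l x).all (p x) :=
  (Poly.any (p := fun x a => !p x a) hl hp.not).not.of_eq fun _ =>
    List.all_eq_not_any_not.symm

theorem Poly.flatMap {l : γ → List α} {h : γ → α → List β} (hl : Poly l)
    (hh : Poly fun p : γ × α => h p.1 p.2) : Poly fun x => (l x).flatMap (h x) := by
  obtain ⟨B, hB, hB'⟩ := Poly.exists_bound hl hh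
  refine (Poly.foldr (g := fun _ => []) (h := fun x a acc => h x a ++ acc) hl (.const _)
    ((hh.comp (Poly.fst.pair (Poly.fst.comp .snd))).append (Poly.snd.comp .snd))
    (fun _ _ => True) B hB (fun _ => trivial)
    (fun x acc a ha _ => ⟨trivial, by
      have := hB' x a ha; have := sz_append (h x a) acc; omega⟩)).of_eq fun x => ?_
  induction l x with
  | nil => rfl
  | cons a l ih => rw [List.foldr_cons, ih, List.flatMap_cons]

/-- The accumulator consists of the reversed result and the unused part of the second list, whose
size is the invariant. The default `d` never enters the result, as the head is used only for
nonempty lists. -/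
theorem Poly.zip {l : γ → List α} {l' : γ → List β} (d : β) (hl : Poly l) (hl' : Poly l') :
    Poly fun x => (l x).zip (l' x) := by
  have h := Poly.foldl (g := fun x => (([] : List (α × β)), l' x))
    (h := fun _ acc a => if acc.2.isEmpty then acc else ((a, acc.2.headD d) :: acc.1, acc.2.tail))
    hl ((Poly.const _).pair hl') (Poly.ite ((Poly.snd.comp (Poly.fst.comp .snd)).isEmpty)
      (Poly.fst.comp .snd) (Poly.pair (((Poly.snd.comp .snd).pair
        ((Poly.snd.comp (Poly.fst.comp .snd)).headD d)).cons
        (Poly.fst.comp (Poly.fst.comp .snd))) (Poly.snd.comp (Poly.fst.comp .snd)).tail))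
    (fun x acc => sz acc.2 ≤ sz (l' x)) (fun x => 2 + sz (l x) + sz (l' x))
    (((PolyBdd.const 2).add hl.polyBdd_sz).add hl'.polyBdd_sz) (fun _ => le_rfl)
    (fun x acc a ha hI => by
      obtain ⟨acc, r⟩ := acc
      have := sz_le_of_mem ha
      cases r with
      | nil => exact ⟨hI, by simp⟩
      | cons b r =>
        simp only [sz_cons] at hI
        simp only [List.isEmpty_cons, Bool.false_eq_true, if_false, List.headD_cons,
          List.tail_cons, sz_pair, sz_cons]
        omega)
  refine (Poly.fst.comp h).reverse.of_eq fun x => ?_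
  have : ∀ (l : List α) (acc : List (α × β)) (r : List β),
      (l.foldl (fun acc a => if acc.2.isEmpty then acc
        else ((a, acc.2.headD d) :: acc.1, acc.2.tail)) (acc, r)).1 = (l.zip r).reverse ++ acc := by
    intro l
    induction l with
    | nil => simp
    | cons a l ih =>
      intro acc r
      cases r with
      | nil => simpa using ih acc []
      | cons b r => simpa using ih ((a, b) :: acc) r
  rw [this, List.append_nil, List.reverse_reverse]

/-! ### Unary numbers -/

theorem Poly.replicate {n : γ → ℕ} (hn : Poly n) : Poly fun x => List.replicate (n x) () :=
  Poly.comp (g := fun n : ℕ => List.replicate n ()) (.of_enc_eq fun n => by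
    simp [enc, List.map_replicate]) hn

theorem Poly.length {l : γ → List α} (hl : Poly l) : Poly fun x => (l x).length := by
  have := Poly.map (h := fun _ _ => ()) hl (.const ())
  exact (Poly.comp (g := fun l : List Unit => l.length) (.of_enc_eq fun l => by
    simp only [enc]; congr 1; simp) this).of_eq fun x => by simp

theorem Poly.succ {n : γ → ℕ} (hn : Poly n) : Poly fun x => n x + 1 := by
  obtain ⟨c, hc, hb⟩ := (Poly.const ()).pair hn
  exact ⟨c, hc, hb⟩

theorem Poly.pred {n : γ → ℕ} (hn : Poly n) : Poly fun x => n x - 1 :=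
  hn.replicate.tail.length.of_eq fun x => by simp

theorem Poly.add {m n : γ → ℕ} (hm : Poly m) (hn : Poly n) : Poly fun x => m x + n x :=
  (hm.replicate.append hn.replicate).length.of_eq fun x => by simp

theorem Poly.sub {m n : γ → ℕ} (hm : Poly m) (hn : Poly n) : Poly fun x => m x - n x := by
  refine (Poly.foldl (h := fun _ acc _ => acc - 1) hn.replicate hm
    (Poly.pred (Poly.fst.comp .snd)) (fun _ _ => True) (fun _ => 0) (.const 0) (fun _ => trivial)
    (fun x acc a _ _ => ⟨trivial, by simp only [sz_nat]; omega⟩)).of_eq fun x => ?_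
  generalize m x = m
  induction n x generalizing m with
  | zero => rfl
  | succ n ih => rw [List.replicate_succ, List.foldl_cons, ih]; omega

theorem Poly.le {m n : γ → ℕ} (hm : Poly m) (hn : Poly n) : Poly fun x => decide (m x ≤ n x) :=
  ((hm.sub hn).eq (.const 0)).of_eq fun x => by simp [Nat.sub_eq_zero_iff_le]

theorem Poly.min {m n : γ → ℕ} (hm : Poly m) (hn : Poly n) : Poly fun x => min (m x) (n x) :=
  (hm.sub (hm.sub hn)).of_eq fun x => by omega

theorem Poly.range {n : γ → ℕ} (hn : Poly n) : Poly fun x => List.range (n x) := by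
  refine (Poly.foldl (g := fun _ => ([] : List ℕ))
    -- The test succeeds in every step of the actual run; it is there to bound the growth for
    -- arbitrary accumulators.
    (h := fun x acc _ => if decide (acc.length + 1 ≤ n x) then acc ++ [acc.length] else acc)
    hn.replicate (.const _) (Poly.ite (Poly.le (Poly.length (Poly.fst.comp .snd)).succ
      (hn.comp .fst)) ((Poly.fst.comp .snd).append ((Poly.length (Poly.fst.comp .snd)).cons
      (.const []))) (Poly.fst.comp .snd)) (fun _ _ => True) (fun x => 2 + sz (n x))
    ((PolyBdd.const 2).add hn.polyBdd_sz) (fun _ => trivial) (fun x acc a _ _ => ⟨trivial, ?_⟩)).of_eq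
    fun x => ?_
  · split_ifs with h
    · have := sz_append acc [acc.length]
      simp only [decide_eq_true_eq] at h
      rw [sz_cons, sz_nil, sz_nat] at this
      rw [sz_nat]; omega
    · omega
  · have : ∀ k ≤ n x, (List.replicate k ()).foldl (fun acc _ =>
        if decide (acc.length + 1 ≤ n x) then acc ++ [acc.length] else acc) [] = List.range k := by
      intro k
      induction k with
      | zero => intro _; rfl
      | succ k ih =>
        intro hk
        rw [List.replicate_succ', List.foldl_append, ih (by omega), List.range_succ]
        simp; omega
    exact this _ le_rfl

/-! ### Functions that are computed without regard to the running time -/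

/-- Functions that are computed by a program. -/
def Computed (f : α → β) : Prop := ∃ c : Fn, ∀ a, c.eval (enc a) = enc (f a)

theorem Poly.computed {f : α → β} (hf : Poly f) : Computed f :=
  let ⟨c, hc, _⟩ := hf
  ⟨c, hc⟩

theorem Computed.comp {g : β → γ} {f : α → β} (hg : Computed g) (hf : Computed f) :
    Computed fun a => g (f a) :=
  let ⟨c, hc⟩ := hg
  let ⟨c', hc'⟩ := hf
  ⟨.comp c c', fun a => by simp only [Fn.eval, hc, hc']⟩

theorem Computed.pair {f : α → β} {g : α → γ} (hf : Computed f) (hg : Computed g) :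
    Computed fun a => (f a, g a) :=
  let ⟨c, hc⟩ := hf
  let ⟨c', hc'⟩ := hg
  ⟨.pair c c', fun a => by simp only [Fn.eval, hc, hc']; rfl⟩

theorem Computed.foldl {l : γ → List α} {g : γ → β} {h : β → α → β} (hl : Computed l)
    (hg : Computed g) (hh : Computed fun p : α × β => h p.2 p.1) :
    Computed fun x => (l x).foldl h (g x) := by
  obtain ⟨s, hs⟩ := hh
  obtain ⟨c, hc⟩ := hl.pair hg
  refine ⟨.comp (.fold s) c, fun x => ?_⟩
  simp only [Fn.eval, hc]
  change T.foldl s.eval (enc (l x)) (enc (g x)) = _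
  generalize g x = acc
  induction l x generalizing acc with
  | nil => rfl
  | cons a l ih =>
    rw [List.foldl_cons, ← ih]
    exact congrArg (T.foldl s.eval (enc l)) (hs (a, acc))

end StackProg

namespace StackProg

open Enc

variable {α γ : Type} [Enc α] [Enc γ]

/-! ### The algorithm and its running time -/

/-- The letters, in binary. -/
abbrev Letter : Type := List Bool

/-- Strings over binary letters. -/
abbrev Str : Type := List Letter

/-- Whether `y` is a prefix of `q`. -/
def isPre (y q : Str) : Bool :=
  (y.foldl (fun r a => (r.1 && decide (r.2 = a :: r.2.tail), r.2.tail)) (true, q)).1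

theorem isPre_iff (y q : Str) : isPre y q = true ↔ y <+: q := by
  have : ∀ (y q : Str) (b : Bool),
      (y.foldl (fun r a => (r.1 && decide (r.2 = a :: r.2.tail), r.2.tail)) (b, q)).1 = true ↔
        b = true ∧ y <+: q := by
    intro y
    induction y with
    | nil => simp
    | cons a y ih =>
      intro q b
      rw [List.foldl_cons, ih]
      cases q with
      | nil => simp
      | cons c q =>
        simp only [Bool.and_eq_true, decide_eq_true_eq, List.tail_cons, List.cons.injEq, and_true,
          List.cons_prefix_cons, and_assoc]
        exact and_congr_right fun _ => and_congr_left fun _ => eq_comm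
  simp [isPre, this]

theorem Poly.isPre {y q : γ → Str} (hy : Poly y) (hq : Poly q) :
    Poly fun x => isPre (y x) (q x) := by
  refine Poly.fst.comp (Poly.foldl (g := fun x => (true, q x))
    (h := fun _ r a => (r.1 && decide (r.2 = a :: r.2.tail), r.2.tail)) hy
    ((Poly.const _).pair hq) (Poly.pair ((Poly.fst.comp (Poly.fst.comp .snd)).and
      ((Poly.snd.comp (Poly.fst.comp .snd)).eq ((Poly.snd.comp .snd).cons
        (Poly.snd.comp (Poly.fst.comp .snd)).tail))) (Poly.snd.comp (Poly.fst.comp .snd)).tail)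
    (fun _ _ => True) (fun _ => 3) (.const 3) (fun _ => trivial) fun x acc a _ _ => ⟨trivial, ?_⟩)
  have h1 := sz_bool (acc.1 && decide (acc.2 = a :: acc.2.tail))
  have h2 := sz_tail_le acc.2
  obtain ⟨b, r⟩ := acc
  simp only [sz_pair] at *
  omega

/-- The suffixes of a list. -/
def suffixes (t : List α) : List (List α) :=
  (t.foldl (fun r _ => (r.2.tail :: r.1, r.2.tail)) ([t], t)).1

theorem mem_suffixes {β : Type} {t u : List β} : u ∈ suffixes t ↔ u <:+ t := by
  have : ∀ (t : List β) (l : List (List β)),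
      (u ∈ (t.foldl (fun r _ => (r.2.tail :: r.1, r.2.tail)) (t :: l, t)).1 ↔
        u ∈ l ∨ u <:+ t) := by
    intro t
    induction t with
    | nil => intro l; simp [or_comm]
    | cons a t ih =>
      intro l
      rw [List.foldl_cons]
      refine (ih ((a :: t) :: l)).trans ?_
      rw [List.mem_cons, List.suffix_cons_iff]
      tauto
  simpa [suffixes] using this t []

theorem Poly.suffixes {t : γ → List α} (ht : Poly t) : Poly fun x => suffixes (t x) := by
  refine Poly.fst.comp (Poly.foldl (g := fun x => ([t x], t x))
    (h := fun _ r _ => (r.2.tail :: r.1, r.2.tail)) ht ((ht.cons (.const [])).pair ht)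
    (Poly.pair ((Poly.snd.comp (Poly.fst.comp .snd)).tail.cons (Poly.fst.comp (Poly.fst.comp .snd)))
      (Poly.snd.comp (Poly.fst.comp .snd)).tail) (fun x r => sz r.2 ≤ sz (t x))
    (fun x => 1 + sz (t x)) ((PolyBdd.const 1).add ht.polyBdd_sz) (fun _ => le_rfl)
    fun x acc a _ hI => ?_)
  obtain ⟨l, r⟩ := acc
  have h2 := sz_tail_le r
  simp only [sz_pair, sz_cons] at *
  omega

/-! ### Binary identifiers for the strings -/

/-- All binary words of some length for which they are at least as many as the members of `S`. -/
def allWords (S : List α) : List (List Bool) :=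
  S.foldl (fun W _ => if decide (W.length ≤ S.length) then
    W.map (List.cons false) ++ W.map (List.cons true) else W) [[]]

/-- `W` consists of the words of length `L`. -/
structure IsAllWords (W : List (List Bool)) (L : ℕ) : Prop where
  mem : ∀ w, w ∈ W ↔ w.length = L
  nodup : W.Nodup
  length : W.length = 2 ^ L

theorem IsAllWords.nil : IsAllWords [[]] 0 := ⟨by simp, by simp, by simp⟩

theorem IsAllWords.double {W : List (List Bool)} {L : ℕ} (h : IsAllWords W L) :
    IsAllWords (W.map (List.cons false) ++ W.map (List.cons true)) (L + 1) where
  mem w := by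
    cases w with
    | nil => simp
    | cons b w => cases b <;> simp [h.mem]
  nodup := by
    refine List.Nodup.append (h.nodup.map (List.cons_injective))
      (h.nodup.map (List.cons_injective)) ?_
    intro w hw hw'
    simp only [List.mem_map] at hw hw'
    obtain ⟨_, _, rfl⟩ := hw
    obtain ⟨_, _, h⟩ := hw'
    simp at h
  length := by simp [h.length, pow_succ]; ring

theorem IsAllWords.le {W : List (List Bool)} {L : ℕ} (h : IsAllWords W L) : L ≤ W.length := by
  rw [h.length]; exact Nat.lt_two_pow_self.le

/-- Either the doubling stops, and then there are more words than members of `S`, or it takes place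
once for each member; then `L` is at least the number of members, and so is `2 ^ L`. -/
theorem allWords_spec {β : Type} (S : List β) : ∃ L, IsAllWords (allWords S) L ∧
    S.length ≤ (allWords S).length := by
  have : ∀ (l : List β) (W : List (List Bool)) (L : ℕ), IsAllWords W L → ∃ L',
      IsAllWords (l.foldl (fun W _ => if decide (W.length ≤ S.length) then
        W.map (List.cons false) ++ W.map (List.cons true) else W) W) L' ∧
      (S.length ≤ (l.foldl (fun W _ => if decide (W.length ≤ S.length) then
        W.map (List.cons false) ++ W.map (List.cons true) else W) W).length ∨
        L + l.length ≤ L') := by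
    intro l
    induction l with
    | nil => intro W L h; exact ⟨L, h, .inr le_rfl⟩
    | cons a l ih =>
      intro W L h
      simp only [List.foldl_cons]
      by_cases hW : W.length ≤ S.length
      · rw [if_pos (by simpa using hW)]
        obtain ⟨L', h', h''⟩ := ih _ _ h.double
        exact ⟨L', h', h''.imp_right fun h => by simp only [List.length_cons]; omega⟩
      · rw [if_neg (by simpa using hW)]
        have : ∀ l : List β, l.foldl (fun W _ => if decide (W.length ≤ S.length) then
            W.map (List.cons false) ++ W.map (List.cons true) else W) W = W := by
          intro l
          induction l with
          | nil => rfl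
          | cons b l ih => rw [List.foldl_cons, if_neg (by simpa using hW), ih]
        rw [this]
        exact ⟨L, h, .inl (by omega)⟩
  obtain ⟨L, h, h'⟩ := this S _ _ .nil
  exact ⟨L, h, h'.elim id fun h' => by have := h.le; simp only [allWords]; omega⟩

theorem Poly.allWords {S : γ → List α} (hS : Poly S) : Poly fun x => allWords (S x) := by
  have hlen : PolyBdd fun x => (S x).length := hS.length.polyBdd_sz.mono fun x => by
    simp only [sz_nat]; omega
  refine Poly.foldl (g := fun _ => ([[]] : List (List Bool)))
    (h := fun x W _ => if decide (W.length ≤ (S x).length) then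
      W.map (List.cons false) ++ W.map (List.cons true) else W) hS (.const _)
    (Poly.ite (Poly.le (Poly.length (Poly.fst.comp .snd)) (Poly.length (hS.comp .fst)))
      ((Poly.map (h := fun _ w => false :: w) (Poly.fst.comp .snd)
        ((Poly.const false).cons .snd)).append
      (Poly.map (h := fun _ w => true :: w) (Poly.fst.comp .snd) ((Poly.const true).cons .snd)))
      (Poly.fst.comp .snd)) (fun _ W => ∃ L, IsAllWords W L)
    -- Doubling happens only up to the length of `S`, so a doubled list has at most twice that many
    -- words. By the invariant it consists of all words of one length, which is therefore no larger
    -- than their number.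
    (fun x => 1 + (2 * (S x).length) * (4 * (2 * (S x).length) + 2)) ((PolyBdd.const 1).add
      (((PolyBdd.const 2).mul hlen).mul (((PolyBdd.const 4).mul ((PolyBdd.const 2).mul hlen)).add
      (.const 2)))) (fun _ => ⟨0, .nil⟩) fun x W _ _ hW => ?_
  obtain ⟨L, hW⟩ := hW
  split_ifs with h
  · refine ⟨⟨_, hW.double⟩, le_add_left ((sz_list_le (B := 1 + 4 * (L + 1)) ?_).trans ?_)⟩
    · intro w hw
      rw [hW.double.mem] at hw
      have := sz_list_le (l := w) (B := 3) fun b _ => sz_bool b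
      omega
    · simp only [decide_eq_true_eq] at h
      have h1 : (W.map (List.cons false) ++ W.map (List.cons true)).length ≤ 2 * (S x).length := by
        simp; omega
      have h2 := hW.double.le.trans h1
      have h3 : 1 + 4 * (L + 1) + 1 ≤ 4 * (2 * (S x).length) + 2 := by omega
      exact Nat.add_le_add_left (Nat.mul_le_mul h1 h3) 1
  · exact ⟨⟨L, hW⟩, Nat.le_add_right _ _⟩

/-- The word that a list of pairs assigns to a string. -/
def idOf (D : List (Str × List Bool)) (y : Str) : List Bool :=
  D.foldl (fun r p => if decide (p.1 = y) then p.2 else r) []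

/-- A repeated member of `S` is paired with several words; the last one is chosen, the same for all
copies. -/
theorem idOf_mem {D : List (Str × List Bool)} {y : Str} (h : ∃ w, (y, w) ∈ D) :
    (y, idOf D y) ∈ D := by
  have : ∀ (D : List (Str × List Bool)) (r : List Bool),
      let z := D.foldl (fun r p => if decide (p.1 = y) then p.2 else r) r
      (y, z) ∈ D ∨ ((¬ ∃ w, (y, w) ∈ D) ∧ z = r) := by
    intro D
    induction D with
    | nil => simp
    | cons p D ih =>
      intro r
      simp only [List.foldl_cons]
      by_cases hp : p.1 = y
      · rw [if_pos (by simpa using hp)]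
        rcases ih p.2 with h | ⟨_, h⟩
        · exact .inl (List.mem_cons_of_mem _ h)
        · exact .inl (by rw [h, ← hp]; simp)
      · rw [if_neg (by simpa using hp)]
        rcases ih r with h | ⟨h', h⟩
        · exact .inl (List.mem_cons_of_mem _ h)
        · refine .inr ⟨?_, h⟩
          rintro ⟨w, hw⟩
          rcases List.mem_cons.1 hw with rfl | hw
          · exact hp rfl
          · exact h' ⟨w, hw⟩
  exact (this D []).resolve_right fun h' => h'.1 h

theorem Poly.idOf {D : γ → List (Str × List Bool)} {y : γ → Str} (hD : Poly D) (hy : Poly y) :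
    Poly fun x => idOf (D x) (y x) := by
  refine Poly.foldl (g := fun _ => ([] : List Bool))
    (h := fun x r p => if decide (p.1 = y x) then p.2 else r) hD (.const _)
    (Poly.ite ((Poly.fst.comp (Poly.snd.comp .snd)).eq (hy.comp .fst))
      (Poly.snd.comp (Poly.snd.comp .snd)) (Poly.fst.comp .snd)) (fun _ _ => True)
    (fun x => sz (D x)) hD.polyBdd_sz (fun _ => trivial) fun x acc p hp _ => ⟨trivial, ?_⟩
  have := sz_le_of_mem hp
  obtain ⟨u, w⟩ := p
  rw [sz_pair] at this
  split_ifs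
  · change sz w ≤ _; omega
  · omega

/-! ### Decision trees on masked words -/

/-- The left subtree. -/
def T.left : T → T
  | .nil => .nil
  | .node l _ => l

/-- The right subtree. -/
def T.right : T → T
  | .nil => .nil
  | .node _ r => r

theorem Poly.left {t : γ → T} (ht : Poly t) : Poly fun x => (t x).left :=
  Poly.comp (g := T.left) ⟨.fst, fun t => by cases t <;> rfl,
    ((PolyBdd.const 60).mul PolyBdd.size).mono fun _ => le_rfl⟩ ht

theorem Poly.right {t : γ → T} (ht : Poly t) : Poly fun x => (t x).right :=
  Poly.comp (g := T.right) ⟨.snd, fun t => by cases t <;> rfl,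
    ((PolyBdd.const 60).mul PolyBdd.size).mono fun _ => le_rfl⟩ ht

theorem sz_left_le (t : T) : sz t.left ≤ sz t := by
  cases t <;> simp only [T.left, sz, enc, id, T.size] <;> omega

theorem sz_right_le (t : T) : sz t.right ≤ sz t := by
  cases t <;> simp only [T.right, sz, enc, id, T.size] <;> omega

/-- Descend in a tree, in the directions given by the bits of a word at the positions that a mask
selects. -/
def walk (P : T) (w m : List Bool) : T :=
  (m.foldl (fun r b => (if b then (if r.2.headD false then r.1.right else r.1.left) else r.1,
    r.2.tail)) (P, w)).1

theorem walk_cons (P : T) (b : Bool) (w : List Bool) (c : Bool) (m : List Bool) :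
    walk P (b :: w) (c :: m) =
      walk (if c then (if b then P.right else P.left) else P) w m := rfl

theorem Poly.walk {P : γ → T} {w m : γ → List Bool} (hP : Poly P) (hw : Poly w) (hm : Poly m) :
    Poly fun x => walk (P x) (w x) (m x) := by
  refine Poly.fst.comp (Poly.foldl (g := fun x => (P x, w x))
    (h := fun _ r b => (if b then (if r.2.headD false then r.1.right else r.1.left) else r.1,
      r.2.tail)) hm (hP.pair hw) (Poly.pair (Poly.ite (Poly.snd.comp .snd)
        (Poly.ite ((Poly.snd.comp (Poly.fst.comp .snd)).headD false)
          (Poly.fst.comp (Poly.fst.comp .snd)).right (Poly.fst.comp (Poly.fst.comp .snd)).left)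
        (Poly.fst.comp (Poly.fst.comp .snd))) (Poly.snd.comp (Poly.fst.comp .snd)).tail)
    (fun _ _ => True) (fun _ => 0) (.const 0) (fun _ => trivial) fun x acc b _ _ => ⟨trivial, ?_⟩)
  obtain ⟨P, w⟩ := acc
  have h1 := sz_tail_le w
  have h2 := sz_left_le P
  have h3 := sz_right_le P
  split_ifs <;> simp only [sz_pair] <;> omega

/-- The stage at which a string is counted. -/
def stage (S : List Str) (m : List Bool) (P : T) (y : Str) : T :=
  walk P (idOf (S.zip (allWords S)) y) m

theorem Poly.stage {S : γ → List Str} {m : γ → List Bool} {P : γ → T} {y : γ → Str} (hS : Poly S)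
    (hm : Poly m) (hP : Poly P) (hy : Poly y) : Poly fun x => stage (S x) (m x) (P x) (y x) :=
  hP.walk ((hS.zip [] hS.allWords).idOf hy) hm

/-! ### The dynamic program -/

/-- The number of members of `S` that are prefixes of `q` and are counted at stage `e`. -/
def weight (S : List Str) (τ : Str → T) (e : ℕ) (q : Str) : ℕ :=
  (S.filter fun y => isPre y q && decide (τ y = enc e)).length

theorem Poly.weight {S : γ → List Str} {τ : γ → Str → T} {e : γ → ℕ} {q : γ → Str} (hS : Poly S)
    (hτ : Poly fun x : γ × Str => τ x.1 x.2) (he : Poly e) (hq : Poly q) :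
    Poly fun x => weight (S x) (τ x) (e x) (q x) := by
  have he' : Poly fun x : γ × Str => (enc (e x.1) : T) :=
    Poly.comp (g := fun n : ℕ => (enc n : T)) (.of_enc_eq fun _ => rfl) (he.comp .fst)
  exact Poly.length (Poly.filter (p := fun x y => StackProg.isPre y (q x) &&
    decide (τ x y = enc (e x))) hS ((Poly.isPre .snd (hq.comp .fst)).and (hτ.eq he')))

/-- The pairs of a suffix of a member of `S` and a number up to the size of `S`. -/
def table (S : List Str) : List (Str × ℕ) :=
  ([] :: S.flatMap suffixes).flatMap fun q => (List.range (S.length + 1)).map fun v => (q, v)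

theorem Poly.table {S : γ → List Str} (hS : Poly S) : Poly fun x => table (S x) :=
  Poly.flatMap (h := fun x q => (List.range ((S x).length + 1)).map fun v => (q, v))
    ((Poly.const []).cons (Poly.flatMap (h := fun _ t => StackProg.suffixes t) hS
      (Poly.suffixes .snd)))
    (Poly.map (h := fun x v => (x.2, v)) (hS.length.succ.range.comp .fst)
      ((Poly.snd.comp .fst).pair .snd))

/-- The entries of the table that are attained at the beginning. -/
def startRow (S : List Str) (τ : Str → T) : List (Str × ℕ) :=
  (table S).filter fun r => decide (r.1 = []) && decide (r.2 ≤ weight S τ 0 [])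

/-- The entries of the table that are attained at stage `e`, if those in `R` are attained before. -/
def nextRow (S : List Str) (τ : Str → T) (R : List (Str × ℕ)) (e : ℕ) : List (Str × ℕ) :=
  (table S).filter fun r => R.any fun r' =>
    isPre r.1.tail r'.1 && decide (r.2 ≤ r'.2 + weight S τ e r.1)

/-- The entries of the table that are attained after all stages. -/
def lastRow (S : List Str) (τ : Str → T) (stages : List ℕ) : List (Str × ℕ) :=
  stages.foldl (nextRow S τ) (startRow S τ)

theorem Poly.startRow {S : γ → List Str} {τ : γ → Str → T} (hS : Poly S)
    (hτ : Poly fun x : γ × Str => τ x.1 x.2) : Poly fun x => startRow (S x) (τ x) :=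
  Poly.filter (p := fun x (r : Str × ℕ) => decide (r.1 = []) &&
    decide (r.2 ≤ StackProg.weight (S x) (τ x) 0 [])) hS.table
    (((Poly.fst.comp .snd).eq (.const [])).and (Poly.le (Poly.snd.comp .snd)
      ((Poly.weight hS hτ (.const 0) (.const [])).comp .fst)))

theorem Poly.nextRow {S : γ → List Str} {τ : γ → Str → T} {R : γ → List (Str × ℕ)} {e : γ → ℕ}
    (hS : Poly S) (hτ : Poly fun x : γ × Str => τ x.1 x.2) (hR : Poly R) (he : Poly e) :
    Poly fun x => nextRow (S x) (τ x) (R x) (e x) := by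
  refine Poly.filter (p := fun x r => (R x).any fun r' => StackProg.isPre r.1.tail r'.1 &&
    decide (r.2 ≤ r'.2 + StackProg.weight (S x) (τ x) (e x) r.1)) hS.table
    (Poly.any (p := fun (x : γ × (Str × ℕ)) r' => StackProg.isPre x.2.1.tail r'.1 &&
      decide (x.2.2 ≤ r'.2 + StackProg.weight (S x.1) (τ x.1) (e x.1) x.2.1)) (hR.comp .fst)
    ((Poly.isPre (Poly.tail (Poly.fst.comp (Poly.snd.comp .fst))) (Poly.fst.comp .snd)).and
      (Poly.le (Poly.snd.comp (Poly.snd.comp .fst)) (Poly.add (Poly.snd.comp .snd)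
      (Poly.comp (g := fun x : γ × (Str × ℕ) =>
        StackProg.weight (S x.1) (τ x.1) (e x.1) x.2.1) (Poly.weight (hS.comp .fst) ?_
          (he.comp .fst) (Poly.fst.comp .snd)) .fst)))))
  exact Poly.comp (g := fun x : γ × Str => τ x.1 x.2) hτ ((Poly.fst.comp .fst).pair .snd)

theorem Poly.lastRow {S : γ → List Str} {τ : γ → Str → T} {stages : γ → List ℕ}
    (hS : Poly S) (hτ : Poly fun x : γ × Str => τ x.1 x.2) (hs : Poly stages) :
    Poly fun x => lastRow (S x) (τ x) (stages x) := by
  refine Poly.foldl (h := fun x R e => StackProg.nextRow (S x) (τ x) R e) hs (hS.startRow hτ)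
    (Poly.nextRow (hS.comp .fst) (hτ.comp ((Poly.fst.comp .fst).pair .snd)) (Poly.fst.comp .snd)
      (Poly.snd.comp .snd)) (fun _ _ => True) (fun x => sz (StackProg.table (S x)))
    hS.table.polyBdd_sz (fun _ => trivial) fun x R e _ _ => ⟨trivial, ?_⟩
  exact le_add_left (sz_le_of_sublist List.filter_sublist)

/-- The search for a superstring that contains `k` members of `S`. -/
def search (S : List Str) (k : ℕ) (stages : List ℕ) (plans : List T) : Bool :=
  (allWords S).any fun m => plans.any fun P =>
    (lastRow S (stage S m P) stages).any fun r => decide (r.2 = k)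

theorem Poly.search {S : γ → List Str} {k : γ → ℕ} {stages : γ → List ℕ} {plans : γ → List T}
    (hS : Poly S) (hk : Poly k) (hs : Poly stages) (hp : Poly plans) :
    Poly fun x => search (S x) (k x) (stages x) (plans x) :=
  Poly.any (p := fun x m => (plans x).any fun P =>
      (StackProg.lastRow (S x) (StackProg.stage (S x) m P) (stages x)).any
        fun r => decide (r.2 = k x)) hS.allWords
    (Poly.any (p := fun (x : γ × List Bool) P =>
      (StackProg.lastRow (S x.1) (StackProg.stage (S x.1) x.2 P) (stages x.1)).any
        fun r => decide (r.2 = k x.1)) (hp.comp .fst)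
    (Poly.any (p := fun (x : (γ × List Bool) × T) r => decide (r.2 = k x.1.1))
      (Poly.lastRow (S := fun x : (γ × List Bool) × T => S x.1.1)
        (τ := fun x => StackProg.stage (S x.1.1) x.1.2 x.2)
        (hS.comp (Poly.fst.comp .fst)) (Poly.stage (hS.comp (Poly.fst.comp (Poly.fst.comp .fst)))
          (Poly.snd.comp (Poly.fst.comp .fst)) (Poly.snd.comp .fst) .snd)
        (hs.comp (Poly.fst.comp .fst)))
      ((Poly.snd.comp .snd).eq (hk.comp (Poly.fst.comp (Poly.fst.comp .fst))))))

end StackProg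

namespace StackProg

open Enc

/-! ### Correctness of the search -/

theorem countP_add_le {α : Type} {p q r : α → Bool} (l : List α) (hp : ∀ y, p y = true → r y = true)
    (hq : ∀ y, q y = true → r y = true) (hpq : ∀ y, p y = true → q y = false) :
    l.countP p + l.countP q ≤ l.countP r := by
  induction l with
  | nil => simp
  | cons a l ih =>
    simp only [List.countP_cons]
    have : (if p a then 1 else 0) + (if q a then 1 else 0) ≤ if r a then 1 else 0 := by
      have h1 := hp a; have h2 := hq a; have h3 := hpq a
      revert h1 h2 h3
      cases p a <;> cases q a <;> cases r a <;> simp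
    omega

theorem countP_le_add {α : Type} {p q r : α → Bool} (l : List α)
    (h : ∀ y ∈ l, r y = true → p y = true ∨ q y = true) :
    l.countP r ≤ l.countP p + l.countP q := by
  induction l with
  | nil => simp
  | cons a l ih =>
    have h1 := h a (by simp)
    have h2 := ih fun y hy => h y (by simp [hy])
    simp only [List.countP_cons]
    have : (if r a then 1 else 0) ≤ (if p a then 1 else 0) + if q a then 1 else 0 := by
      revert h1
      cases p a <;> cases q a <;> cases r a <;> simp
    omega

theorem weight_eq (S : List Str) (τ : Str → T) (e : ℕ) (q : Str) :
    weight S τ e q = S.countP fun y => decide (y <+: q ∧ τ y = enc e) := by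
  rw [weight, ← List.countP_eq_length_filter]
  congr 1
  funext y
  rw [Bool.eq_iff_iff]
  simp [isPre_iff]

theorem mem_table {S : List Str} {q : Str} {v : ℕ} :
    (q, v) ∈ table S ↔ (q = [] ∨ ∃ y ∈ S, q <:+ y) ∧ v ≤ S.length := by
  simp only [table, List.mem_flatMap, List.mem_cons, mem_suffixes, List.mem_map, List.mem_range,
    Prod.mk.injEq, Nat.lt_succ_iff]
  constructor
  · rintro ⟨_, h, _, h', rfl, rfl⟩
    exact ⟨h, h'⟩
  · rintro ⟨h, h'⟩
    exact ⟨_, h, _, h', rfl, rfl⟩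

/-- The stages after the first. -/
def stageList (n : ℕ) : List ℕ := (List.range n).map fun e => e + 1

theorem lastRow_succ (S : List Str) (τ : Str → T) (n : ℕ) :
    lastRow S τ (stageList (n + 1)) = nextRow S τ (lastRow S τ (stageList n)) (n + 1) := by
  simp [lastRow, stageList, List.range_succ]

open Classical in
-- No assumption on `τ` is needed: different stages count disjoint parts of `S`, because a string
-- counted at stage `e` satisfies `τ y = enc e`. Hence no occurrence in the list is counted twice.
theorem lastRow_sound {S : List Str} {τ : Str → T} {n : ℕ} {q : Str} {v : ℕ}
    (h : (q, v) ∈ lastRow S τ (stageList n)) : ∃ s : Str, s.length = n ∧ q <+: s ∧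
      v ≤ S.countP fun y => decide (y <:+: s ∧ ∃ e ≤ n, τ y = enc e) := by
  induction n generalizing q v with
  | zero =>
    change (q, v) ∈ startRow S τ at h
    simp only [startRow, List.mem_filter, Bool.and_eq_true, decide_eq_true_eq, weight_eq] at h
    refine ⟨[], rfl, by simp [h.2.1], h.2.2.trans (List.countP_mono_left fun y _ hy => ?_)⟩
    simp only [decide_eq_true_eq] at hy ⊢
    exact ⟨hy.1.isInfix, 0, le_rfl, hy.2⟩
  | succ n ih =>
    rw [lastRow_succ] at h
    simp only [nextRow, List.mem_filter, List.any_eq_true, Bool.and_eq_true, decide_eq_true_eq,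
      weight_eq, isPre_iff] at h
    obtain ⟨-, ⟨q', v'⟩, hr, hq, hv⟩ := h
    obtain ⟨s, hs, hqs, hv'⟩ := ih hr
    -- The new letter is forced by `q` unless `q` is empty; then any letter will do, for instance
    -- `[]`.
    refine ⟨q.headD [] :: s, by simp [hs], ?_, ?_⟩
    · cases q with
      | nil => simp
      | cons a q => simpa using hq.trans hqs
    · have hpre : q <+: q.headD [] :: s := by
        cases q with
        | nil => simp
        | cons a q => simpa using hq.trans hqs
      refine hv.trans ((Nat.add_le_add_right hv' _).trans (countP_add_le S ?_ ?_ ?_))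
      · intro y hy
        simp only [decide_eq_true_eq] at hy ⊢
        obtain ⟨hy, e, he, hτ⟩ := hy
        exact ⟨hy.trans (List.suffix_cons _ _).isInfix, e, by omega, hτ⟩
      · intro y hy
        simp only [decide_eq_true_eq] at hy ⊢
        exact ⟨(hy.1.trans hpre).isInfix, n + 1, le_rfl, hy.2⟩
      · intro y hy
        simp only [decide_eq_true_eq, decide_eq_false_iff_not] at hy ⊢
        obtain ⟨-, e, he, hτ⟩ := hy
        rintro ⟨-, hτ'⟩
        have := inj (hτ.symm.trans hτ')
        omega

open Classical in
-- The dynamic program has a fixed number of stages, so a shorter superstring is padded with the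
-- arbitrary letter `[]` to length exactly `n`.
theorem hasPartialSuperstring_iff (S : List Str) (k n : ℕ) :
    HasPartialSuperstring (S : Multiset Str) k n ↔
      ∃ s : Str, s.length = n ∧ k ≤ S.countP fun y => decide (y <:+: s) := by
  constructor
  · rintro ⟨s, hs, S', hS', hk, h⟩
    refine ⟨s ++ List.replicate (n - s.length) [], by simp; omega, hk.trans ?_⟩
    have : S' ≤ Multiset.filter (fun y => y <:+: s ++ List.replicate (n - s.length) []) S :=
      Multiset.le_filter.2 ⟨hS', fun x hx => (h x hx).trans (List.prefix_append _ _).isInfix⟩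
    have := Multiset.card_le_card this
    rwa [Multiset.filter_coe, Multiset.coe_card, ← List.countP_eq_length_filter] at this
  · rintro ⟨s, hs, hk⟩
    refine ⟨s, hs.le, Multiset.filter (fun y => y <:+: s) S, Multiset.filter_le _ _, ?_,
      fun x hx => (Multiset.mem_filter.1 hx).2⟩
    rwa [Multiset.filter_coe, Multiset.coe_card, ← List.countP_eq_length_filter]

theorem search_sound {S : List Str} {k n : ℕ} {plans : List T}
    (h : search S k (stageList n) plans = true) :
    HasPartialSuperstring (S : Multiset Str) k n := by
  classical
  simp only [search, List.any_eq_true, decide_eq_true_eq] at h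
  obtain ⟨m, -, P, -, ⟨q, v⟩, hr, rfl⟩ := h
  obtain ⟨s, hs, -, hv⟩ := lastRow_sound hr
  exact (hasPartialSuperstring_iff S v n).2 ⟨s, hs, hv.trans (List.countP_mono_left fun y _ hy => by
    simp only [decide_eq_true_eq] at hy ⊢; exact hy.1)⟩

/-! ### Completeness of the dynamic program -/

/-- A member of the table that is a prefix of `t`, as long as possible. -/
def IsLongest (S : List Str) (t q : Str) : Prop :=
  (q = [] ∨ ∃ y ∈ S, q <:+ y) ∧ q <+: t ∧
    ∀ q', (q' = [] ∨ ∃ y ∈ S, q' <:+ y) → q' <+: t → q'.length ≤ q.length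

theorem exists_isLongest (S : List Str) (t : Str) : ∃ q, IsLongest S t q := by
  classical
  obtain ⟨q, hq, hmax⟩ := Finset.exists_max_image
    (t.inits.toFinset.filter fun q => q = [] ∨ ∃ y ∈ S, q <:+ y) List.length
    ⟨[], by simp⟩
  simp only [Finset.mem_filter, List.mem_toFinset, List.mem_inits] at hq hmax
  exact ⟨q, hq.2, hq.1, fun q' h h' => hmax q' ⟨h', h⟩⟩

/-- Suffixes of members of `S` are closed under removing the first letter, so `q'.tail` competes
with `q` among the prefixes of `t`. This is the compatibility that `nextRow` tests. -/
theorem IsLongest.tail {S : List Str} {a : Letter} {t q q' : Str} (h : IsLongest S t q)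
    (h' : IsLongest S (a :: t) q') : q'.tail <+: q := by
  have h1 : q'.tail <+: t := by
    cases q' with
    | nil => simp
    | cons b q' => simpa using (List.cons_prefix_cons.1 h'.2.1).2
  refine List.prefix_of_prefix_length_le h1 h.2.1 (h.2.2 _ ?_ h1)
  rcases h'.1 with h | ⟨y, hy, h⟩
  · exact .inl (by simp [h])
  · exact .inr ⟨y, hy, (List.tail_suffix _).trans h⟩

open Classical in
-- Here `pos y` is the distance from the start of a chosen occurrence of `y` to the end of `s`,
-- which is the stage at which that start is reached. The minimum with `k` keeps the count within
-- the range of the table.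
theorem lastRow_complete {S : List Str} {τ : Str → T} {s : Str} {n k : ℕ} (hs : s.length = n)
    (pos : Str → ℕ) (hpos : ∀ y ∈ S, y <:+: s → y <+: s.drop (n - pos y) ∧ τ y = enc (pos y))
    (hk : k ≤ S.length) (e : ℕ) (he : e ≤ n) : ∃ q, IsLongest S (s.drop (n - e)) q ∧
      (q, min k (S.countP fun y => decide (y <:+: s ∧ pos y ≤ e))) ∈
        lastRow S τ (stageList e) := by
  induction e with
  | zero =>
    obtain ⟨q, hq⟩ := exists_isLongest S (s.drop (n - 0))
    have hd : s.drop (n - 0) = [] := by simp [hs]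
    have hq0 : q = [] := List.prefix_nil.1 (hd ▸ hq.2.1)
    refine ⟨q, hq, ?_⟩
    change _ ∈ startRow S τ
    simp only [startRow, List.mem_filter, Bool.and_eq_true, decide_eq_true_eq, weight_eq,
      mem_table]
    refine ⟨⟨hq.1, (min_le_left _ _).trans hk⟩, hq0, (min_le_right _ _).trans
      (List.countP_mono_left fun y hy h => ?_)⟩
    simp only [decide_eq_true_eq, Nat.le_zero] at h ⊢
    obtain ⟨h1, h2⟩ := hpos y hy h.1
    rw [h.2] at h1 h2
    exact ⟨hd ▸ h1, h2⟩
  | succ e ih =>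
    obtain ⟨q, hq, hrow⟩ := ih (by omega)
    obtain ⟨q', hq'⟩ := exists_isLongest S (s.drop (n - (e + 1)))
    refine ⟨q', hq', ?_⟩
    have hdrop : ∃ a, s.drop (n - (e + 1)) = a :: s.drop (n - e) := by
      refine ⟨s[n - (e + 1)], ?_⟩
      rw [List.drop_eq_getElem_cons (by omega)]
      congr 2
      omega
    rw [lastRow_succ]
    simp only [nextRow, List.mem_filter, List.any_eq_true, Bool.and_eq_true, decide_eq_true_eq,
      weight_eq, isPre_iff, mem_table]
    refine ⟨⟨hq'.1, (min_le_left _ _).trans hk⟩, _, hrow, ?_, ?_⟩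
    · obtain ⟨a, ha⟩ := hdrop
      rw [ha] at hq'
      exact hq.tail hq'
    · have := countP_le_add S (r := fun y => decide (y <:+: s ∧ pos y ≤ e + 1))
        (p := fun y => decide (y <:+: s ∧ pos y ≤ e))
        (q := fun y => decide (y <+: q' ∧ τ y = enc (e + 1))) fun y hy hr => by
          simp only [decide_eq_true_eq] at hr ⊢
          by_cases hye : pos y ≤ e
          · exact .inl ⟨hr.1, hye⟩
          · obtain ⟨h1, h2⟩ := hpos y hy hr.1
            have : pos y = e + 1 := by omega
            rw [this] at h1 h2
            -- A member of `S` that starts here is itself a candidate for the longest prefix, hence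
            -- a prefix of `q'`.
            exact .inr ⟨List.prefix_of_prefix_length_le h1 hq'.2.1
              (hq'.2.2 y (.inr ⟨y, hy, List.suffix_refl y⟩) h1), h2⟩
      omega

/-! ### Masks and decision trees for the stages -/

/-- The height of a tree. -/
def T.height : T → ℕ
  | .nil => 0
  | .node l r => max l.height r.height + 1

theorem height_enc (n : ℕ) : (enc n : T).height = n := by
  induction n with
  | zero => rfl
  | succ n ih =>
    change max 0 (enc n : T).height + 1 = _
    rw [ih]; omega

/-- For a set of words of the same length there is a mask such that any function of these words is
given by descending in a tree of small height. -/
theorem exists_mask (h L : ℕ) (Y : Finset (List Bool)) (hY : ∀ w ∈ Y, w.length = L) :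
    ∃ m : List Bool, m.length = L ∧ ∀ g : List Bool → T, (∀ w, (g w).height ≤ h) →
      ∃ P : T, P.height ≤ h + Y.card ∧ ∀ w ∈ Y, walk P w m = g w := by
  classical
  induction L generalizing Y with
  | zero =>
    refine ⟨[], rfl, fun g hg => ⟨g [], (hg []).trans (Nat.le_add_right _ _), fun w hw => ?_⟩⟩
    rw [List.length_eq_zero_iff.1 (hY w hw)]
    rfl
  | succ L ih =>
    obtain ⟨m, hm, hP⟩ := ih (Y.image List.tail) (by
      intro w hw
      obtain ⟨u, hu, rfl⟩ := Finset.mem_image.1 hw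
      simp [hY u hu])
    -- The first bit is selected only if the other bits fail to separate the words. Selecting it
    -- adds one level to the tree, and this is paid for by the loss of at least one element in the
    -- image of `Y`.
    by_cases hinj : Set.InjOn List.tail (Y : Set (List Bool))
    · refine ⟨false :: m, by simp [hm], fun g hg => ?_⟩
      -- The skipped bit is recovered by inverting `List.tail` on `Y`.
      obtain ⟨P, hPh, hPw⟩ := hP (fun w => g (Function.invFunOn List.tail (Y : Set (List Bool)) w))
        fun w => hg _
      refine ⟨P, hPh.trans (Nat.add_le_add_left Finset.card_image_le _), fun w hw => ?_⟩
      have := hPw w.tail (Finset.mem_image_of_mem _ hw)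
      rw [hinj.leftInvOn_invFunOn hw] at this
      cases w with
      | nil => simpa using hY _ hw
      | cons b w => rw [walk_cons]; exact this
    · refine ⟨true :: m, by simp [hm], fun g hg => ?_⟩
      -- The mask was fixed before the function, so both subtrees can use the same one.
      obtain ⟨P₀, h₀, hP₀⟩ := hP (fun w => g (false :: w)) fun w => hg _
      obtain ⟨P₁, h₁, hP₁⟩ := hP (fun w => g (true :: w)) fun w => hg _
      have hcard : (Y.image List.tail).card < Y.card :=
        lt_of_le_of_ne Finset.card_image_le fun h => hinj (Finset.card_image_iff.1 h)
      refine ⟨.node P₀ P₁, by simp only [T.height]; omega, fun w hw => ?_⟩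
      cases w with
      | nil => simpa using hY _ hw
      | cons b w =>
        have hw' : w ∈ Y.image List.tail := Finset.mem_image.2 ⟨_, hw, rfl⟩
        rw [walk_cons]
        cases b
        · exact hP₀ w hw'
        · exact hP₁ w hw'

theorem eq_of_mem_zip {α β : Type} {S : List α} {W : List β} (hW : W.Nodup) {y y' : α} {w : β}
    (h : (y, w) ∈ S.zip W) (h' : (y', w) ∈ S.zip W) : y = y' := by
  obtain ⟨i, hi, hyi⟩ := List.mem_iff_getElem.1 h
  obtain ⟨j, hj, hyj⟩ := List.mem_iff_getElem.1 h'
  simp only [List.getElem_zip, Prod.mk.injEq] at hyi hyj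
  have : i = j := (hW.getElem_inj_iff).1 (hyi.2.trans hyj.2.symm)
  subst this
  exact hyi.1.symm.trans hyj.1

theorem exists_mem_zip {α β : Type} {S : List α} {W : List β} (h : S.length ≤ W.length) {y : α}
    (hy : y ∈ S) : ∃ w, (y, w) ∈ S.zip W := by
  obtain ⟨i, hi, rfl⟩ := List.mem_iff_getElem.1 hy
  exact ⟨W[i], List.mem_iff_getElem.2 ⟨i, by simp; omega, by simp⟩⟩

/-- The identifiers of the members of `S` that occur in `s` form a small set of words of length `L`.
A mask and a tree for this set reproduce the chosen positions, and both are among those tried. -/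
theorem search_complete {S : List Str} {k n : ℕ} {plans : List T}
    (hplans : ∀ P : T, P.height ≤ n + (n + 1) * (n + 1) → P ∈ plans)
    (h : HasPartialSuperstring (S : Multiset Str) k n) :
    search S k (stageList n) plans = true := by
  classical
  obtain ⟨s, hs, hk⟩ := (hasPartialSuperstring_iff S k n).1 h
  have hpos : ∀ y, ∃ p, p ≤ n ∧ (y <:+: s → y <+: s.drop (n - p)) := by
    intro y
    by_cases hy : y <:+: s
    · obtain ⟨u, v, huv⟩ := hy
      have hlen := congrArg List.length huv
      simp only [List.length_append] at hlen
      -- The occurrence starts after `u`, and positions are measured from the end of `s`.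
      refine ⟨n - u.length, Nat.sub_le _ _, fun _ => ⟨v, ?_⟩⟩
      rw [show n - (n - u.length) = u.length by omega, ← huv, List.append_assoc,
        List.drop_left]
    · exact ⟨0, Nat.zero_le _, fun h => absurd h hy⟩
  choose pos hpos_le hpos using hpos
  obtain ⟨L, hW, hlen⟩ := allWords_spec S
  set Z : Finset Str := S.toFinset.filter fun y => y <:+: s with hZ
  have hZmem : ∀ y, y ∈ Z ↔ y ∈ S ∧ y <:+: s := by simp [hZ]
  have hZcard : Z.card ≤ (n + 1) * (n + 1) := by
    -- A substring of `s` is determined by its start and its length.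
    have : Z ⊆ ((Finset.range (n + 1)) ×ˢ (Finset.range (n + 1))).image
        fun p => (s.drop p.1).take p.2 := by
      intro y hy
      obtain ⟨u, v, huv⟩ := ((hZmem y).1 hy).2
      have hlen := congrArg List.length huv
      simp only [List.length_append] at hlen
      refine Finset.mem_image.2 ⟨(u.length, y.length), ?_, ?_⟩
      · simp only [Finset.mem_product, Finset.mem_range]; omega
      · rw [← huv, List.append_assoc, List.drop_left, List.take_left]
    refine (Finset.card_le_card this).trans (Finset.card_image_le.trans ?_)
    simp
  set f : Str → List Bool := idOf (S.zip (allWords S)) with hf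
  have hfmem : ∀ y ∈ S, (y, f y) ∈ S.zip (allWords S) := fun y hy =>
    idOf_mem (exists_mem_zip hlen hy)
  have hinj : Set.InjOn f (Z : Set Str) := by
    intro y hy y' hy' hyy'
    have h1 := hfmem y ((hZmem y).1 hy).1
    have h2 := hfmem y' ((hZmem y').1 hy').1
    rw [← hyy'] at h2
    exact eq_of_mem_zip hW.nodup h1 h2
  obtain ⟨m, hm, hP⟩ := exists_mask n L (Z.image f) (by
    intro w hw
    obtain ⟨y, hy, rfl⟩ := Finset.mem_image.1 hw
    exact (hW.mem _).1 (List.of_mem_zip (hfmem y ((hZmem y).1 hy).1)).2)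
  -- The identifiers are injective on `Z`, so the position is a function of the identifier. The code
  -- of a number has that number as height, which gives the bound `n` on the heights of the values.
  obtain ⟨P, hPh, hPw⟩ := hP (fun w => enc (pos (Function.invFunOn f (Z : Set Str) w)))
    fun w => by rw [height_enc]; exact hpos_le _
  have hτ : ∀ y ∈ S, y <:+: s → stage S m P y = enc (pos y) := by
    intro y hy hys
    have hyZ : y ∈ Z := (hZmem y).2 ⟨hy, hys⟩
    have := hPw (f y) (Finset.mem_image_of_mem _ hyZ)
    rwa [hinj.leftInvOn_invFunOn hyZ] at this
  obtain ⟨q, -, hq⟩ := lastRow_complete hs pos (τ := stage S m P)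
    (fun y hy hys => ⟨hpos y hys, hτ y hy hys⟩) (hk.trans List.countP_le_length) n le_rfl
  simp only [search, List.any_eq_true, decide_eq_true_eq]
  refine ⟨m, (hW.mem m).2 hm, P, hplans P (hPh.trans ?_), _, hq, ?_⟩
  · exact Nat.add_le_add_left (Finset.card_image_le.trans hZcard) _
  · simp only [hpos_le, and_true]
    exact min_eq_left hk

end StackProg

namespace StackProg

open Enc Computability

/-! ### Binary numbers -/

/-- The number with given binary digits. -/
def valBits (u : List Bool) : ℕ := u.foldr (fun b n => if b then n + n + 1 else n + n) 0

/-- The number with given binary digits, or `c` if that is smaller. -/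
def capBits (c : ℕ) (u : List Bool) : ℕ :=
  u.foldr (fun b n => min c (if b then n + n + 1 else n + n)) 0

/-- Capping at every digit does no harm, because once the value reaches `c`, doubling cannot bring
it below `c` again. -/
theorem capBits_eq (c : ℕ) (u : List Bool) : capBits c u = min c (valBits u) := by
  induction u with
  | nil => simp [capBits, valBits]
  | cons b u ih =>
    simp only [capBits, valBits, List.foldr_cons] at *
    rw [ih]
    cases b <;> simp <;> omega

theorem valBits_encodePosNum (p : PosNum) : valBits (encodePosNum p) = p := by
  induction p with
  | one => simp [encodePosNum, valBits]
  | bit0 p ih =>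
    simp only [encodePosNum, valBits, List.foldr_cons, PosNum.cast_bit0] at *
    rw [ih]; simp
  | bit1 p ih =>
    simp only [encodePosNum, valBits, List.foldr_cons, PosNum.cast_bit1] at *
    rw [ih]; simp

theorem valBits_encodeNat (n : ℕ) : valBits (encodeNat n) = n := by
  have h := Num.to_of_nat n
  unfold encodeNat
  generalize (n : Num) = m at h
  subst h
  cases m with
  | zero => rfl
  | pos p => exact valBits_encodePosNum p

/-- Whether a word is the binary representation of a number. -/
def isCanonical (u : List Bool) : Bool := u.reverse.headD true

/-- The most significant digit comes last. The default `false` makes the statement include that the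
word is nonempty, whereas the default `true` in `isCanonical` admits the empty word, which stands
for zero. -/
theorem isCanonical_encodePosNum (p : PosNum) :
    (encodePosNum p).reverse.headD false = true := by
  induction p with
  | one => rfl
  | bit0 p ih => simp only [encodePosNum, List.reverse_cons]; revert ih; cases (encodePosNum p).reverse <;> simp
  | bit1 p ih => simp only [encodePosNum, List.reverse_cons]; revert ih; cases (encodePosNum p).reverse <;> simp

theorem isCanonical_encodeNat (n : ℕ) : isCanonical (encodeNat n) = true := by
  unfold encodeNat
  cases (n : Num) with
  | zero => rfl
  | pos p =>
    have := isCanonical_encodePosNum p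
    simp only [isCanonical, encodeNum]
    revert this
    cases (encodePosNum p).reverse <;> simp

theorem exists_encodePosNum {u : List Bool} (h : u.reverse.headD false = true) :
    ∃ p, encodePosNum p = u := by
  induction u with
  | nil => simp at h
  | cons b u ih =>
    by_cases hu : u = []
    · subst hu
      exact ⟨.one, by simp at h; simp [encodePosNum, h]⟩
    · obtain ⟨p, rfl⟩ := ih (by
        rw [List.reverse_cons] at h
        rcases hr : u.reverse with _ | ⟨c, l⟩
        · simp at hr; exact absurd hr hu
        · rw [hr] at h; simpa using h)
      cases b
      · exact ⟨.bit0 p, rfl⟩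
      · exact ⟨.bit1 p, rfl⟩

theorem encodeNat_valBits {u : List Bool} (h : isCanonical u = true) :
    encodeNat (valBits u) = u := by
  by_cases hu : u = []
  · subst hu; rfl
  · obtain ⟨p, rfl⟩ := exists_encodePosNum (u := u) (by
      unfold isCanonical at h
      rcases hr : u.reverse with _ | ⟨c, l⟩
      · simp at hr; exact absurd hr hu
      · rw [hr] at h; simpa using h)
    rw [valBits_encodePosNum, encodeNat, PosNum.of_to_nat]
    rfl

/-! ### Lists from the end -/

section

variable {α β : Type}

/-- The last element of a list. -/
def lastOr (d : α) (l : List α) : α := l.reverse.headD d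

/-- A list without its last element. -/
def front (l : List α) : List α := l.reverse.tail.reverse

@[simp] theorem lastOr_append (d a : α) (l : List α) : lastOr d (l ++ [a]) = a := by simp [lastOr]

@[simp] theorem front_append (a : α) (l : List α) : front (l ++ [a]) = l := by simp [front]

theorem front_append_lastOr (d a : α) (l : List α) :
    front (a :: l) ++ [lastOr d (a :: l)] = a :: l := by
  obtain ⟨l', b, h⟩ : ∃ l' b, a :: l = l' ++ [b] :=
    ⟨_, _, (List.dropLast_append_getLast (List.cons_ne_nil a l)).symm⟩
  rw [h]; simp

/-- The texts of the members of a list, with separators in between. -/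
def sepText (f : α → List β) (s : β) (a : α) (l : List α) : List β :=
  f a ++ l.flatMap fun b => s :: f b

theorem sepText_cons (f : α → List β) (s : β) (a b : α) (l : List α) :
    sepText f s a (b :: l) = f a ++ s :: sepText f s b l := by simp [sepText]

/-- The parser sees separators, while the encoding uses terminators. A separator between two members
is a terminator of all members but the last. -/
theorem sepText_eq (f : α → List β) (s : β) {a r : α} {l l' : List α} (h : a :: l = l' ++ [r]) :
    sepText f s a l = (l'.flatMap fun b => f b ++ [s]) ++ f r := by
  induction l' generalizing a l with
  | nil => simp at h; simp [sepText, h]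
  | cons b l' ih =>
    cases l with
    | nil => simp at h
    | cons c l =>
      simp only [List.cons_append, List.cons.injEq] at h
      rw [sepText_cons, ih h.2, h.1]
      simp

end

/-! ### Parsing -/

/-- The symbols of the input. -/
abbrev Sym : Type := InstanceSymbol ⊕ Bool

/-- The number of a symbol. -/
def symIdx : Sym → ℕ
  | .inl (.bit false) => 0
  | .inl (.bit true) => 1
  | .inl .endLetter => 2
  | .inl .endString => 3
  | .inr false => 4
  | .inr true => 5

theorem symIdx_injective : Function.Injective symIdx := by
  rintro ((⟨_ | _⟩ | _ | _) | (_ | _)) ((⟨_ | _⟩ | _ | _) | (_ | _)) <;> simp [symIdx]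

instance : DecidableEq Sym := fun a b =>
  decidable_of_iff (symIdx a = symIdx b) symIdx_injective.eq_iff

instance : Fintype Sym where
  elems := {.inl (.bit false), .inl (.bit true), .inl .endLetter, .inl .endString, .inr false,
    .inr true}
  complete := by rintro ((⟨_ | _⟩ | _ | _) | (_ | _)) <;> simp

instance : Enc Sym := ⟨fun s => enc (symIdx s), fun _ _ h => symIdx_injective (inj h)⟩

theorem sz_sym (s : Sym) : sz s ≤ 11 := by
  have : sz s = sz (symIdx s) := rfl
  rw [this, sz_nat]
  rcases s with ((⟨_ | _⟩ | _ | _) | (_ | _)) <;> simp [symIdx]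

/-- A group of letters. -/
abbrev Group : Type := Letter × List Letter

/-- Read one symbol, from right to left. -/
def parseStep (st : Group × List Group) (s : Sym) : Group × List Group :=
  if decide (s = .inl (.bit false)) then ((false :: st.1.1, st.1.2), st.2)
  else if decide (s = .inl (.bit true)) then ((true :: st.1.1, st.1.2), st.2)
  else if decide (s = .inl .endLetter) then (([], st.1.1 :: st.1.2), st.2)
  else if decide (s = .inl .endString) then (([], []), st.1 :: st.2)
  else st

/-- Parse the reverse of the input. -/
def parse (v : List Sym) : Group × List Group := v.foldl parseStep (([], []), [])

/-- Extract the digits of the parameter from the reverse of the input. -/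
def paramBits (v : List Sym) : List Bool :=
  v.foldl (fun acc s => if decide (s = .inr false) then false :: acc
    else if decide (s = .inr true) then true :: acc else acc) []

theorem Poly.parse : Poly parse := by
  have h1 : Poly fun p : List Sym × (Group × List Group) × Sym => p.2.2 := Poly.snd.comp .snd
  have h2 : Poly fun p : List Sym × (Group × List Group) × Sym => p.2.1 := Poly.fst.comp .snd
  refine Poly.foldl (γ := List Sym) (l := fun v => v) (g := fun _ => ((([], []), []) : Group × List Group))
    (h := fun _ st s => parseStep st s) .id (.const _)
    (Poly.ite (h1.eq (.const _)) ((((Poly.const false).cons (Poly.fst.comp (Poly.fst.comp h2))).pair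
      (Poly.snd.comp (Poly.fst.comp h2))).pair (Poly.snd.comp h2))
    (Poly.ite (h1.eq (.const _)) ((((Poly.const true).cons (Poly.fst.comp (Poly.fst.comp h2))).pair
      (Poly.snd.comp (Poly.fst.comp h2))).pair (Poly.snd.comp h2))
    (Poly.ite (h1.eq (.const _)) (((Poly.const []).pair ((Poly.fst.comp (Poly.fst.comp h2)).cons
      (Poly.snd.comp (Poly.fst.comp h2)))).pair (Poly.snd.comp h2))
    (Poly.ite (h1.eq (.const _)) ((Poly.const ([], [])).pair ((Poly.fst.comp h2).cons
      (Poly.snd.comp h2))) h2))))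
    (fun _ _ => True) (fun _ => 10) (.const 10) (fun _ => trivial) fun x st s _ _ => ⟨trivial, ?_⟩
  obtain ⟨⟨u, g⟩, G⟩ := st
  have := sz_bool false
  have := sz_bool true
  unfold parseStep
  split_ifs <;> simp only [sz_pair, sz_cons, sz_nil] <;> omega

theorem Poly.paramBits : Poly paramBits := by
  have h1 : Poly fun p : List Sym × List Bool × Sym => p.2.2 := Poly.snd.comp .snd
  have h2 : Poly fun p : List Sym × List Bool × Sym => p.2.1 := Poly.fst.comp .snd
  refine Poly.foldl (γ := List Sym) (l := fun v => v) (g := fun _ => ([] : List Bool))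
    (h := fun _ acc s => if decide (s = .inr false) then false :: acc
      else if decide (s = .inr true) then true :: acc else acc) .id (.const _)
    (Poly.ite (h1.eq (.const _)) ((Poly.const false).cons h2) (Poly.ite (h1.eq (.const _))
      ((Poly.const true).cons h2) h2))
    (fun _ _ => True) (fun _ => 10) (.const 10) (fun _ => trivial) fun x st s _ _ => ⟨trivial, ?_⟩
  have := sz_bool false
  have := sz_bool true
  split_ifs
  · rw [sz_cons]; omega
  · rw [sz_cons]; omega
  · omega

/-- The digits of the parameter leave the state unchanged, and the left fold over the reversed word
is a right fold over `I`. -/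
theorem parse_reverse (I : List InstanceSymbol) (p : ℕ) :
    parse (ParameterizedProblem.inputWord I p).reverse =
      I.foldr (fun s st => parseStep st (.inl s)) (([], []), []) := by
  have : ∀ (l : List Bool) st, l.foldr (fun b st => parseStep st (.inr b)) st = st := by
    intro l st
    induction l with
    | nil => rfl
    | cons b l ih => rw [List.foldr_cons, ih]; simp [parseStep]
  rw [parse, List.foldl_reverse, ParameterizedProblem.inputWord, List.foldr_append,
    List.foldr_map, List.foldr_map, this]

theorem paramBits_reverse (I : List InstanceSymbol) (p : ℕ) :
    paramBits (ParameterizedProblem.inputWord I p).reverse = encodeNat p := by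
  rw [paramBits, List.foldl_reverse, ParameterizedProblem.inputWord, List.foldr_append,
    List.foldr_map, List.foldr_map]
  have h1 : ∀ l : List Bool, l.foldr (fun b acc => if decide ((.inr b : Sym) = .inr false) then
      false :: acc else if decide ((.inr b : Sym) = .inr true) then true :: acc else acc) [] =
      l := by
    intro l
    induction l with
    | nil => rfl
    | cons b l ih => rw [List.foldr_cons, ih]; cases b <;> simp
  rw [h1]
  induction I with
  | nil => rfl
  | cons s I ih => rw [List.foldr_cons, ih]; simp

/-- The text of a group. -/
def textGroup (g : Group) : List InstanceSymbol :=
  sepText (fun u => u.map .bit) .endLetter g.1 g.2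

/-- The text that has been parsed. -/
def textState (st : Group × List Group) : List InstanceSymbol :=
  sepText textGroup .endString st.1 st.2

/-- Together with `foldr_textState` this shows that every word, well-formed or not, is the text of
exactly one state. Whether it encodes an instance can therefore be tested on that state. -/
theorem textState_foldr (I : List InstanceSymbol) :
    textState (I.foldr (fun s st => parseStep st (.inl s)) (([], []), [])) = I := by
  induction I with
  | nil => rfl
  | cons s I ih =>
    rw [List.foldr_cons]
    generalize I.foldr (fun s st => parseStep st (.inl s)) (([], []), []) = st at ih ⊢
    rw [← ih]
    obtain ⟨⟨u, g⟩, G⟩ := st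
    rcases s with (_ | _) | _ | _ <;> simp [parseStep, textState, textGroup, sepText]

theorem foldr_textGroup (g : Group) (G : List Group) :
    (textGroup g).foldr (fun s st => parseStep st (.inl s)) (([], []), G) = (g, G) := by
  have hbits : ∀ (u : Letter) (r : Letter) (us : List Letter),
      (u.map InstanceSymbol.bit).foldr (fun s st => parseStep st (.inl s)) ((r, us), G) =
        ((u ++ r, us), G) := by
    intro u r us
    induction u with
    | nil => rfl
    | cons b u ih => rw [List.map_cons, List.foldr_cons, ih]; cases b <;> simp [parseStep]
  obtain ⟨u, us⟩ := g
  induction us generalizing u with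
  | nil => simpa [textGroup, sepText] using hbits u [] []
  | cons r us ih =>
    have h := ih r
    simp only [textGroup] at h ⊢
    rw [sepText_cons, List.foldr_append, List.foldr_cons, h]
    simpa [parseStep] using hbits u [] (r :: us)

theorem foldr_textState (st : Group × List Group) :
    (textState st).foldr (fun s st => parseStep st (.inl s)) (([], []), []) = st := by
  obtain ⟨g, G⟩ := st
  induction G generalizing g with
  | nil => simpa [textState, sepText] using foldr_textGroup g []
  | cons g' G ih =>
    have h := ih g'
    simp only [textState] at h ⊢
    rw [sepText_cons, List.foldr_append, List.foldr_cons, h]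
    simpa [parseStep] using foldr_textGroup g (g' :: G)

/-- Whether a group is the text of a string. -/
def isStr (g : Group) : Bool :=
  (lastOr [] (g.1 :: g.2)).isEmpty && (front (g.1 :: g.2)).all isCanonical

/-- The string of a group. -/
def strOf (g : Group) : Str := front (g.1 :: g.2)

/-- The decision on a parsed input. -/
def accepts (st : Group × List Group) (stages : List ℕ) (plans : List T) : Bool :=
  (lastOr ([], []) (st.1 :: st.2)).2.isEmpty && (isCanonical (lastOr ([], []) (st.1 :: st.2)).1 &&
    ((front (st.1 :: st.2)).all isStr && search ((front (st.1 :: st.2)).map strOf)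
      (capBits ((front (st.1 :: st.2)).length + 1) (lastOr ([], []) (st.1 :: st.2)).1) stages plans))

section

variable {α γ : Type} [Enc α] [Enc γ]

theorem Poly.lastOr {l : γ → List α} (hl : Poly l) (d : α) : Poly fun x => lastOr d (l x) :=
  hl.reverse.headD d

theorem Poly.front {l : γ → List α} (hl : Poly l) : Poly fun x => front (l x) :=
  hl.reverse.tail.reverse

theorem Poly.isCanonical {u : γ → List Bool} (hu : Poly u) : Poly fun x => isCanonical (u x) :=
  hu.reverse.headD true

theorem Poly.capBits {u : γ → List Bool} {c : γ → ℕ} (hc : Poly c) (hu : Poly u) :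
    Poly fun x => capBits (c x) (u x) := by
  have h2 : Poly fun p : γ × Bool × ℕ => p.2.2 := Poly.snd.comp .snd
  refine Poly.foldr (g := fun _ => 0)
    (h := fun x b n => Min.min (c x) (if b then n + n + 1 else n + n)) hu (.const 0)
    (Poly.min (hc.comp .fst) (Poly.ite (Poly.fst.comp .snd) (h2.add h2).succ (h2.add h2)))
    (fun _ _ => True) (fun x => sz (c x)) hc.polyBdd_sz (fun _ => trivial)
    fun x n b _ _ => ⟨trivial, ?_⟩
  simp only [sz_nat]
  omega

theorem Poly.group {g : γ → Group} (hg : Poly g) : Poly fun x => (g x).1 :: (g x).2 :=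
  (Poly.fst.comp hg).cons (Poly.snd.comp hg)

theorem Poly.accepts {st : γ → Group × List Group} {stages : γ → List ℕ} {plans : γ → List T}
    (hst : Poly st) (hs : Poly stages) (hp : Poly plans) :
    Poly fun x => accepts (st x) (stages x) (plans x) := by
  have hL : Poly fun x => (st x).1 :: (st x).2 := (Poly.fst.comp hst).cons (Poly.snd.comp hst)
  have hk := hL.lastOr ([], [])
  have hg := hL.front
  refine (Poly.isEmpty (Poly.snd.comp hk)).and ((Poly.isCanonical (Poly.fst.comp hk)).and
    (Poly.and (Poly.all (p := fun _ g => isStr g) hg ?_)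
      (Poly.search (Poly.map (h := fun _ g => strOf g) hg (Poly.front (Poly.group .snd)))
        (Poly.capBits hg.length.succ (Poly.fst.comp hk)) hs hp)))
  exact (Poly.isEmpty (Poly.lastOr (Poly.group .snd) [])).and
    (Poly.all (p := fun _ u => StackProg.isCanonical u) (Poly.front (Poly.group .snd))
      (Poly.isCanonical .snd))

end

/-- Replacing letters preserves substrings, so injectivity of `f` is not required. This is used with
`valBits` in one direction and `encodeNat` in the other. -/
theorem hasPartialSuperstring_map {α β : Type} (f : α → β) {S : List (List α)} {k n : ℕ}
    (h : HasPartialSuperstring (S : Multiset (List α)) k n) :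
    HasPartialSuperstring (S.map (List.map f) : Multiset (List β)) k n := by
  obtain ⟨s, hs, S', hS', hk, h⟩ := h
  refine ⟨s.map f, by simpa using hs, S'.map (List.map f), ?_, by simpa using hk, ?_⟩
  · rw [← Multiset.map_coe]
    exact Multiset.map_le_map hS'
  · intro x hx
    obtain ⟨y, hy, rfl⟩ := Multiset.mem_map.1 hx
    exact (h y hy).map f

theorem le_length_of_hasPartialSuperstring {α : Type} {S : List (List α)} {k n : ℕ}
    (h : HasPartialSuperstring (S : Multiset (List α)) k n) : k ≤ S.length := by
  obtain ⟨s, -, S', hS', hk, -⟩ := h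
  exact hk.trans (by simpa using Multiset.card_le_card hS')

/-- The group of a string. -/
def groupOf : Str → Group
  | [] => ([], [])
  | u :: us => (u, us ++ [[]])

theorem groupOf_cons (s : Str) : (groupOf s).1 :: (groupOf s).2 = s ++ [[]] := by
  cases s <;> rfl

/-- As the encoding closes every letter and every string, the group of a string ends in an empty
letter, and what follows the last `endString` is the number `k`. -/
theorem encodeInstance_eq (S : List (List ℕ)) (k : ℕ) {st : Group × List Group}
    {gs : List Group} {kg : Group} (hst : st.1 :: st.2 = gs ++ [kg])
    (hkg : kg = (encodeNat k, [])) (hgs : ∀ g ∈ gs, lastOr [] (g.1 :: g.2) = [])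
    (hS : gs.map strOf = S.map (List.map encodeNat)) :
    textState st = InstanceSymbol.encodeInstance S k := by
  rw [textState, sepText_eq _ _ hst, InstanceSymbol.encodeInstance]
  congr 1
  · have h1 : ∀ g ∈ gs, textGroup g ++ [.endString] =
        ((strOf g).flatMap fun u => u.map .bit ++ [.endLetter]) ++ [.endString] := by
      intro g hg
      have h := front_append_lastOr [] g.1 g.2
      rw [textGroup, sepText_eq _ _ h.symm, hgs g hg]
      simp [strOf]
    have h2 : (gs.flatMap fun g => textGroup g ++ [InstanceSymbol.endString]) =
        (gs.map strOf).flatMap fun s =>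
          (s.flatMap fun u => u.map .bit ++ [.endLetter]) ++ [.endString] := by
      rw [List.flatMap_map]
      exact List.flatMap_congr h1
    rw [h2, hS, List.flatMap_map]
    congr 1
    funext s
    simp [InstanceSymbol.encodeString, InstanceSymbol.encodeNumber, List.flatMap_map]
  · rw [hkg]; simp [textGroup, sepText, InstanceSymbol.encodeNumber]

theorem accepts_iff (I : List InstanceSymbol) (p n : ℕ) {plans : List T}
    (hplans : ∀ P : T, P.height ≤ n + (n + 1) * (n + 1) → P ∈ plans) :
    accepts (parse (ParameterizedProblem.inputWord I p).reverse) (stageList n) plans = true ↔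
      (I, n) ∈ partialSuperstringByLength := by
  rw [parse_reverse]
  constructor
  · intro h
    have hI := textState_foldr I
    generalize I.foldr (fun s st => parseStep st (.inl s)) (([], []), []) = st at h hI
    simp only [accepts, Bool.and_eq_true, List.isEmpty_iff, List.all_eq_true] at h
    obtain ⟨h1, h2, h3, h4⟩ := h
    have hst := (front_append_lastOr ([], []) st.1 st.2).symm
    generalize lastOr ([], []) (st.1 :: st.2) = kg at h1 h2 h4 hst
    generalize front (st.1 :: st.2) = gs at h3 h4 hst
    have h3' : ∀ g ∈ gs, lastOr [] (g.1 :: g.2) = [] ∧ ∀ u ∈ strOf g, isCanonical u = true := by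
      intro g hg
      have := h3 g hg
      simpa only [isStr, strOf, Bool.and_eq_true, List.isEmpty_iff, List.all_eq_true] using this
    have h5 := search_sound h4
    have h6 := le_length_of_hasPartialSuperstring h5
    rw [capBits_eq] at h5 h6
    rw [List.length_map] at h6
    -- A successful search bounds the capped number by the size of `S`. The cap is one larger, so it
    -- was not effective, and the number is the true `k`.
    rw [min_eq_right (by omega)] at h5
    refine ⟨(gs.map strOf).map (List.map valBits), valBits kg.1, ?_, hasPartialSuperstring_map _ h5⟩
    refine hI.symm.trans (encodeInstance_eq _ _ hst ?_ (fun g hg => (h3' g hg).1) ?_)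
    · rw [encodeNat_valBits h2]; exact Prod.ext rfl h1
    · rw [List.map_map]
      refine (List.map_id _).symm.trans (List.map_congr_left fun s hs => ?_)
      obtain ⟨g, hg, rfl⟩ := List.mem_map.1 hs
      simp only [Function.comp_apply, List.map_map, id]
      refine (List.map_id _).symm.trans (List.map_congr_left fun u hu => ?_)
      exact (encodeNat_valBits ((h3' g hg).2 u hu)).symm
  · rintro ⟨S, k, hI, h⟩
    simp only at hI h
    obtain ⟨st, hst⟩ : ∃ st : Group × List Group, st.1 :: st.2 =
        (S.map fun s => groupOf (s.map encodeNat)) ++ [(encodeNat k, [])] := by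
      cases hL : (S.map fun s => groupOf (s.map encodeNat)) ++ [(encodeNat k, [])] with
      | nil => simp at hL
      | cons g G => exact ⟨(g, G), rfl⟩
    have hstr : (S.map fun s => groupOf (s.map encodeNat)).map strOf =
        S.map (List.map encodeNat) := by
      rw [List.map_map]
      refine List.map_congr_left fun s _ => ?_
      simp only [Function.comp_apply, strOf, groupOf_cons, front_append]
    have ht := encodeInstance_eq S k hst rfl (by
      intro g hg
      obtain ⟨s, -, rfl⟩ := List.mem_map.1 hg
      simp only [groupOf_cons, lastOr_append]) hstr
    rw [hI, ← ht, foldr_textState]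
    have h' := hasPartialSuperstring_map encodeNat h
    have hk := le_length_of_hasPartialSuperstring h
    simp only [accepts, hst, lastOr_append, front_append, hstr, Bool.and_eq_true, List.isEmpty_iff,
      List.all_eq_true, capBits_eq, valBits_encodeNat, isCanonical_encodeNat, List.length_map,
      true_and]
    refine ⟨?_, ?_⟩
    · intro g hg
      obtain ⟨s, -, rfl⟩ := List.mem_map.1 hg
      simp only [isStr, groupOf_cons, lastOr_append, front_append, List.isEmpty_nil, Bool.true_and,
        List.all_eq_true]
      intro u hu
      obtain ⟨a, -, rfl⟩ := List.mem_map.1 hu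
      exact isCanonical_encodeNat a
    · rw [min_eq_right (by omega)]
      exact search_complete hplans h'

end StackProg

namespace StackProg

open Enc Turing

/-! ### The data that depend on the parameter only -/

/-- One more level of trees. -/
def treesStep (L : List T) : List T := .nil :: L.flatMap fun a => L.map fun b => .node a b

/-- All trees of height at most `n`. -/
def trees (n : ℕ) : List T := (List.replicate n ()).foldl (fun L _ => treesStep L) [.nil]

theorem mem_trees (n : ℕ) (P : T) (h : P.height ≤ n) : P ∈ trees n := by
  induction n generalizing P with
  | zero =>
    cases P with
    | nil => simp [trees]
    | node a b => simp [T.height] at h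
  | succ n ih =>
    have : trees (n + 1) = treesStep (trees n) := by
      rw [trees, List.replicate_succ', List.foldl_append]; rfl
    rw [this, treesStep]
    cases P with
    | nil => simp
    | node a b =>
      simp only [T.height] at h
      simpa using ⟨ih a (by omega), ih b (by omega)⟩

/-- A number as a list. -/
def units (n : ℕ) : List Unit := List.replicate n ()

/-- The trees that encode the candidates for the positions of the strings. -/
def planList (n : ℕ) : List T :=
  trees (n + ((units (n + 1)).flatMap fun _ => units (n + 1)).length)

theorem mem_planList (n : ℕ) (P : T) (h : P.height ≤ n + (n + 1) * (n + 1)) : P ∈ planList n :=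
  mem_trees _ _ (by simpa [units] using h)

theorem Poly.node {γ : Type} [Enc γ] {a b : γ → T} (ha : Poly a) (hb : Poly b) :
    Poly fun x => T.node (a x) (b x) := by
  obtain ⟨c, hc, h⟩ := ha.pair hb
  exact ⟨c, hc, h⟩

theorem computed_trees : Computed trees := by
  refine Computed.foldl (Poly.computed (Poly.replicate .id))
    (Poly.computed (.const _)) (Poly.computed ?_)
  exact (Poly.const T.nil).cons (Poly.flatMap Poly.snd (Poly.map (Poly.snd.comp .fst)
    (Poly.node (Poly.snd.comp .fst) .snd)))

theorem computed_valBits : Computed valBits := by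
  have h2 : Poly fun p : Bool × ℕ => p.2 := .snd
  obtain ⟨c, hc⟩ := Computed.foldl (γ := List Bool) (l := fun u => u.reverse) (g := fun _ => 0)
    (h := fun n b => if b then n + n + 1 else n + n) (Poly.computed (Poly.reverse .id))
    (Poly.computed (.const 0)) (Poly.computed (Poly.ite .fst (h2.add h2).succ (h2.add h2)))
  exact ⟨c, fun u => by simp only [hc, List.foldl_reverse]; rfl⟩

/-- The data for the search that depend on the parameter. -/
def paramData (u : List Bool) : List ℕ × List T := (stageList (valBits u), planList (valBits u))

theorem computed_paramData : Computed paramData := by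
  have hu : Poly fun n : ℕ => units (n + 1) := Poly.replicate (Poly.succ .id)
  have h1 : Computed stageList :=
    Poly.computed (Poly.map (Poly.range .id) (Poly.succ .snd))
  have h2 : Computed planList :=
    computed_trees.comp (Poly.computed (Poly.add .id (Poly.length (Poly.flatMap hu (hu.comp .fst)))))
  exact (h1.comp computed_valBits).pair (h2.comp computed_valBits)

/-! ### The running time -/

/-- A decision procedure that is polynomial apart from a computation on the parameter. -/
theorem exists_code {ι κ σ δ : Type} [Enc ι] [Enc κ] [Enc σ] [Enc δ] {f : ι → σ} {g : ι → κ}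
    {D : κ → δ} {A : σ × δ → Bool} (hf : Poly f) (hg : Poly g) (hD : Computed D) (hA : Poly A) :
    ∃ (c : Fn) (t : κ → ℕ) (e : ℕ), ∀ v, c.eval (enc v) = enc (A (f v, D (g v))) ∧
      c.cost (enc v) ≤ (sz v + 2 * t (g v) + 3) ^ e := by
  have hsf := hf.polyBdd_sz
  obtain ⟨cf, hcf, hbf⟩ := hf
  obtain ⟨cg, hcg, hbg⟩ := hg
  obtain ⟨cD, hcD⟩ := hD
  obtain ⟨cA, hcA, d, hd⟩ := hA
  -- The time and the output size of the unrestricted computation are treated as a unary second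
  -- input, so that the calculus of polynomial bounds applies to the pair.
  have h1 : PolyBdd fun p : ι × ℕ => sz p.1 := Poly.fst.polyBdd_sz
  have h2 : PolyBdd fun p : ι × ℕ => p.2 :=
    (Poly.snd (α := ι) (β := ℕ)).polyBdd_sz.mono fun p => by rw [sz_nat]; omega
  obtain ⟨e, he⟩ := (((((hbf.comp h1).add ((hbg.comp h1).add h2)).add
    ((PolyBdd.const 60).mul h1)).add ((PolyBdd.const 60).mul (hsf.comp h1))).add
    ((((PolyBdd.const 2).add (hsf.comp h1)).add h2).pow d))
  refine ⟨.comp cA (.pair cf (.comp cD cg)), fun k => cD.cost (enc k) + sz (D k), e, fun v => ?_⟩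
  have hev : (Fn.pair cf (.comp cD cg)).eval (enc v) = enc (f v, D (g v)) := by
    simp only [Fn.eval, hcf, hcg, hcD]; rfl
  refine ⟨by simp only [Fn.eval] at hev ⊢; rw [hev, hcA], ?_⟩
  have h := he (v, cD.cost (enc (g v)) + sz (D (g v)))
  simp only [sz_pair, sz_nat] at h
  have h3 := hd (f v, D (g v))
  simp only [sz_pair] at h3
  have h4 : (1 + sz (f v) + sz (D (g v)) + 1) ^ d ≤
      (2 + sz (f v) + (cD.cost (enc (g v)) + sz (D (g v)))) ^ d :=
    Nat.pow_le_pow_left (by omega) d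
  refine le_trans ?_ (h.trans (Nat.pow_le_pow_left (by simp only; omega) e))
  simp only [Fn.cost]
  rw [hev, hcf, hcg]
  change _ + _ + 60 * sz v + 60 * sz (f v) + _ ≤ _
  omega

end StackProg

open StackProg in
theorem corollary1 : partialSuperstringByLength.IsFPT := by
  classical
  have hA : Poly fun p : (Group × List Group) × (List ℕ × List T) => accepts p.1 p.2.1 p.2.2 :=
    Poly.accepts .fst (Poly.fst.comp .snd) (Poly.snd.comp .snd)
  obtain ⟨c, t, e, hc⟩ := exists_code Poly.parse Poly.paramBits computed_paramData hA
  obtain ⟨C, hC⟩ := machine_outputs (Enc.enc : Sym → T) c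
  -- A symbol has a code of size at most 11 and takes up one more as a list entry, hence the factor
  -- 12. The exponent `e + 1` is positive, so the same power also absorbs the linear time for
  -- reading the input.
  refine ⟨machine Enc.enc c, fun p => (C + 1) * (24 + 12 * (Computability.encodeNat p).length +
    2 * t (Computability.encodeNat p)) ^ (e + 1), e + 1, fun I p => ?_⟩
  have henc : T.ofList ((ParameterizedProblem.inputWord I p).map Enc.enc).reverse =
      Enc.enc (ParameterizedProblem.inputWord I p).reverse := by
    rw [← List.map_reverse]; rfl
  obtain ⟨h1, h2⟩ := hc (ParameterizedProblem.inputWord I p).reverse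
  rw [paramBits_reverse] at h1 h2
  have hlen : (ParameterizedProblem.inputWord I p).length =
      I.length + (Computability.encodeNat p).length := by
    simp [ParameterizedProblem.inputWord]
  have hsz := sz_list_le (l := (ParameterizedProblem.inputWord I p).reverse) (B := 11)
    fun s _ => sz_sym s
  rw [List.length_reverse, hlen] at hsz
  have hr : accepts (parse (ParameterizedProblem.inputWord I p).reverse)
      (paramData (Computability.encodeNat p)).1 (paramData (Computability.encodeNat p)).2 =
      decide ((I, p) ∈ partialSuperstringByLength) := by
    rw [Bool.eq_iff_iff, decide_eq_true_iff]
    simp only [paramData, valBits_encodeNat]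
    exact accepts_iff I p p (mem_planList p)
  obtain ⟨⟨⟨s, hs⟩, hm⟩⟩ := hC (ParameterizedProblem.inputWord I p)
    (decide ((I, p) ∈ partialSuperstringByLength)) (by rw [henc, h1, hr]; rfl)
  refine ⟨⟨⟨s, ?_⟩, hm.trans ?_⟩⟩
  · convert hs
  rw [henc, hlen]
  set b := (Computability.encodeNat p).length
  set X := 24 + 12 * b + 2 * t (Computability.encodeNat p)
  -- The sum that bounds the cost is turned into a product, which separates the parameter from the
  -- length of the input.
  have h4 : X + 24 * I.length ≤ X * (I.length + 1) := by
    rw [mul_add, mul_one, add_comm]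
    exact Nat.add_le_add_right (Nat.mul_le_mul_right _ (by omega)) _
  have h3 := h2.trans (Nat.pow_le_pow_left (m := X * (I.length + 1)) (by omega) e)
  calc C * (I.length + b + 1) + c.cost (Enc.enc (ParameterizedProblem.inputWord I p).reverse)
      ≤ C * (X * (I.length + 1)) ^ (e + 1) + (X * (I.length + 1)) ^ (e + 1) :=
        Nat.add_le_add (Nat.mul_le_mul_left C ((by omega : _ ≤ X * (I.length + 1)).trans
          (Nat.le_self_pow (by omega) _)))
          (h3.trans (Nat.pow_le_pow_right (by omega) (by omega)))
    _ = (C + 1) * X ^ (e + 1) * (I.length + 1) ^ (e + 1) := by rw [mul_pow]; ring
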